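/- Let $(D,\mu)$ be a probability space and let $(b_k)_{k\in\mathbb N_0}$, $b_k\colon D\to\mathbb C$, be an orthonormal system in $L_2(D,\mu)$ with $b_0=1$. Put $V_m=\operatorname{span}\{b_0,\dots,b_{m-1}\}$ and assume that, for some $\theta\ge 1/2$ and $C_1>0$, $$\Lambda(V_m,B(D)):=\sup_{g\in V_m\setminus\{0\}}\frac{\sup_{x\in D}|g(x)|}{\|g\|_{2}}\le C_1\,m^{\theta}\qquad(m\ge 2).\tag{1}$$ **Construction of points and weights.** Input: $m,n\in\mathbb N$ with $n\ge m$, an $L_2$-orthonormal tuple $a=(a_1,\dots,a_m)$ and a finite tuple $b=(b^{(1)},\dots,b^{(M)})$ of functions in $L_2(D,\mu)$. Set $J=\int bb^*\,d\mu$, $r=\sqrt{m/(n+1)}$, $\sigma=\sqrt{\lambda_{\max}(J)}$, $s=\sqrt{\operatorname{Tr}(J)/n}$, $\delta_*=\frac{1-r}{n+1}$, $\zeta_*=\frac{\sigma+s}{\sigma n}$, and initially $G=r(1-r)I_m$, $\Gamma=-s(\sigma+s)I_M$, $\ell=u=0$. Choose $0<\delta\le\delta_*$ and $\zeta\ge\zeta_*$.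 In each of the steps $i=1,\dots,n$ put $$L=(G-\ell I)^{-1},\quad L_\delta=(G-(\ell+\delta)I)^{-1},\quad U=(uJ-\Gamma)^{-1},\quad U_\zeta=((u+\zeta)J-\Gamma)^{-1},$$ $$V=\frac{L_\delta^2}{\operatorname{Tr}(L_\delta-L)}-L_\delta,\qquad W=\frac{U_\zeta JU_\zeta}{\operatorname{Tr}(JU-JU_\zeta)}+U_\zeta .$$ An arbitrary oracle suggests points until a point $x_i\in D$ with $a(x_i)^*Va(x_i)\ge b(x_i)^*Wb(x_i)$ is found; then choose any $w_i>0$ with $w_i^{-1}$ between these two values, and replace $G$ by $G+w_i\,a(x_i)a(x_i)^*$, $\Gamma$ by $\Gamma+w_i\,b(x_i)b(x_i)^*$, $\ell$ by $\ell+\delta$, and $u$ by $u+\zeta$. The output consists of the points $x_1,\dots,x_n$ and the weights $w_1,\dots,w_n$. **Theorem.** Let $\alpha_0>\theta$ and $t\in(\theta,\alpha_0)$. For $m\in\mathbb N$ (so $m\ge1$) choose any $N\in\mathbb N_0$ with $N\ge m^{\alpha_0/(\alpha_0-\theta)}-m$ and run the construction with $n=2m$ and $$a=(b_0,\dots,b_{m-1}),\quad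 b=\big(c,\ k^{-t}b_k\big)_{m\le k<N},\quad c=m^{-t}+\sqrt{\tfrac1{2m}\textstyle\sum_{k=m}^{N}k^{-2t}},\quad (\delta,\zeta)=(\delta_*,\zeta_*)$$ (the first entry of $b$ is the constant function $c$, and empty sums are $0$). Then an output exists. For every output $(x_i,w_i)_{i\le 2m}$ the weighted least squares algorithm $$A_mf=\operatorname*{arg\,min}_{g\in V_m}\sum_{i=1}^{2m}w_i\,|f(x_i)-g(x_i)|^2$$ is well defined, that is, the minimizer exists and is unique for every $f\colon D\to\mathbb C$. Moreover, let $1\le p\le\infty$, let $\alpha\ge\alpha_0$, $\beta\ge0$ and $C_2>0$, and let $f\in L_2(D,\mu)$ be a bounded function with pointwise convergent Fourier series, i.e. $f(x)=\sum_{k\ge0}\langle f,b_k\rangle_2\,b_k(x)$ for all $x\in D$. If $$d(f,V_k)_2:=\inf_{g\in V_k}\|f-g\|_2\le C_2\,k^{-\alpha}\log^\beta k\qquad\text{for all }k\ge2,\tag{2}$$ then, for every $m\ge2$ and every output of the construction, $$\|f-A_mf\|_p\le C\,m^{-\alpha+\theta(1-2/p)_+}\log^\beta m,$$ where for $p=\infty$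 the bound holds both for the essential supremum and for the supremum over $D$. The constant $C>0$ depends only on $C_1$, $C_2$, $\alpha$, $\beta$, $\theta$, $p$ and $t$; in particular, it does not depend on $(D,\mu)$, $(b_k)$, $\alpha_0$, $m$, $N$, $f$, or the output. -/

import Mathlib

open MeasureTheory Filter Topology
open scoped ENNReal

noncomputable section

namespace WLS

/-- `b 0, b 1, …` is an orthonormal system of (genuine, complex valued) functions in `L₂(D, μ)`. -/
def IsOrthonormalSystem {D : Type*} [MeasurableSpace D] (μ : Measure D) (b : ℕ → D → ℂ) : Prop :=
  (∀ k, MemLp (b k) 2 μ) ∧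
    ∀ j k, ∫ x, b j x * star (b k x) ∂μ = if j = k then 1 else 0

/-- The space `V_m = span {b_k : 0 ≤ k < m}`. -/
def approxSpace {D : Type*} (b : ℕ → D → ℂ) (m : ℕ) : Submodule ℂ (D → ℂ) :=
  Submodule.span ℂ (b '' Set.Iio m)

/-- The (unnormalised) sup-norm `sup_{x ∈ D} |g x|` of `B(D)`, with value `∞` for unbounded `g`. -/
def supNorm {D : Type*} (g : D → ℂ) : ℝ≥0∞ := ⨆ x, ‖g x‖ₑ

/-- `Λ(V, B(D)) = sup { ‖g‖_∞ / ‖g‖₂ : g ∈ V, g ≠ 0 }`. -/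
def christoffelSup {D : Type*} [MeasurableSpace D] (μ : Measure D)
    (V : Submodule ℂ (D → ℂ)) : ℝ≥0∞ :=
  ⨆ g ∈ V, ⨆ _ : g ≠ 0, supNorm g / eLpNorm g 2 μ

/-- The error of best `L₂`-approximation `d(f, V)₂ = inf { ‖f - g‖₂ : g ∈ V }`. -/
def bestL2 {D : Type*} [MeasurableSpace D] (μ : Measure D)
    (f : D → ℂ) (V : Submodule ℂ (D → ℂ)) : ℝ≥0∞ :=
  ⨅ g ∈ V, eLpNorm (f - g) 2 μ

/-- `f` has a pointwise convergent Fourier series: at every single point `x`, the partial sums of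
`∑ k, ⟨f, b_k⟩₂ b_k(x)` converge to `f(x)`. -/
def HasPointwiseFourierSeries {D : Type*} [MeasurableSpace D] (μ : Measure D)
    (b : ℕ → D → ℂ) (f : D → ℂ) : Prop :=
  ∀ x, Tendsto (fun M : ℕ => ∑ k ∈ Finset.range M, (∫ y, f y * star (b k y) ∂μ) * b k x)
    atTop (𝓝 (f x))

/-- `g` is a minimiser over `V` of `∑ i, w_i |f(x_i) - g(x_i)|²`. -/
def IsLeastSquares {D : Type*} {n : ℕ} (V : Submodule ℂ (D → ℂ)) (x : Fin n → D) (w : Fin n → ℝ)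
    (f g : D → ℂ) : Prop :=
  g ∈ V ∧ ∀ h ∈ V, ∑ i, w i * ‖f (x i) - g (x i)‖ ^ 2 ≤ ∑ i, w i * ‖f (x i) - h (x i)‖ ^ 2

/-! ### The greedy construction of points and weights

The input is `a : D → ℂ^m` (an `L₂`-orthonormal tuple), `b : D → ℂ^κ` (a finite tuple of functions
in `L₂`) and the number `n` of points. -/

/-- The rank-one matrix `v v^*`. -/
def outer {κ : Type*} (v : κ → ℂ) : Matrix κ κ ℂ := Matrix.vecMulVec v (star v)

/-- The quadratic form `v^* M v` (real for Hermitian `M`). -/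
def quadForm {κ : Type*} [Fintype κ] (M : Matrix κ κ ℂ) (v : κ → ℂ) : ℝ :=
  (star v ⬝ᵥ M.mulVec v).re

/-- `J = ∫ b b^* dμ`. -/
def gramJ {D : Type*} [MeasurableSpace D] (μ : Measure D) {κ : Type*} (b : D → κ → ℂ) :
    Matrix κ κ ℂ :=
  Matrix.of fun i j => ∫ x, outer (b x) i j ∂μ

/-- The largest (real) eigenvalue of a Hermitian matrix. -/
def lambdaMax {κ : Type*} [Fintype κ] [DecidableEq κ] (M : Matrix κ κ ℂ) : ℝ :=
  sSup (spectrum ℝ M)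

/-- `r = √(m / (n + 1))`. -/
def rParam (m n : ℕ) : ℝ := Real.sqrt ((m : ℝ) / ((n : ℝ) + 1))

/-- `σ = √(λ_max(J))`. -/
def sigmaParam {κ : Type*} [Fintype κ] [DecidableEq κ] (J : Matrix κ κ ℂ) : ℝ :=
  Real.sqrt (lambdaMax J)

/-- `s = √(Tr(J) / n)`. -/
def sParam {κ : Type*} [Fintype κ] (n : ℕ) (J : Matrix κ κ ℂ) : ℝ :=
  Real.sqrt (J.trace.re / (n : ℝ))

/-- `δ_* = (1 - r) / (n + 1)`. -/
def deltaStar (m n : ℕ) : ℝ := (1 - rParam m n) / ((n : ℝ) + 1)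

/-- `ζ_* = (σ + s) / (σ n)`. -/
def zetaStar {κ : Type*} [Fintype κ] [DecidableEq κ] (n : ℕ) (J : Matrix κ κ ℂ) : ℝ :=
  (sigmaParam J + sParam n J) / (sigmaParam J * (n : ℝ))

/-- The variables `G, Γ, ℓ, u` updated by the construction. -/
structure AlgState (m : ℕ) (κ : Type*) where
  G : Matrix (Fin m) (Fin m) ℂ
  Γ : Matrix κ κ ℂ
  l : ℝ
  u : ℝ

/-- The initial values `G = r (1 - r) I`, `Γ = -s (σ + s) I`, `ℓ = u = 0`. -/
def initState (m n : ℕ) {κ : Type*} [Fintype κ] [DecidableEq κ] (J : Matrix κ κ ℂ) :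
    AlgState m κ where
  G := ((rParam m n * (1 - rParam m n) : ℝ) : ℂ) • (1 : Matrix (Fin m) (Fin m) ℂ)
  Γ := ((-(sParam n J * (sigmaParam J + sParam n J)) : ℝ) : ℂ) • (1 : Matrix κ κ ℂ)
  l := 0
  u := 0

/-- `(G - ℓ I)⁻¹`. -/
def resolventL {m : ℕ} (G : Matrix (Fin m) (Fin m) ℂ) (l : ℝ) : Matrix (Fin m) (Fin m) ℂ :=
  (G - (l : ℂ) • (1 : Matrix (Fin m) (Fin m) ℂ))⁻¹

/-- `(u J - Γ)⁻¹`. -/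
def resolventU {κ : Type*} [Fintype κ] [DecidableEq κ] (J Γ : Matrix κ κ ℂ) (u : ℝ) :
    Matrix κ κ ℂ :=
  ((u : ℂ) • J - Γ)⁻¹

/-- `V = L_δ² / Tr(L_δ - L) - L_δ`. -/
def matV {m : ℕ} {κ : Type*} (δ : ℝ) (S : AlgState m κ) : Matrix (Fin m) (Fin m) ℂ :=
  (resolventL S.G (S.l + δ) - resolventL S.G S.l).trace⁻¹ • resolventL S.G (S.l + δ) ^ 2
    - resolventL S.G (S.l + δ)

/-- `W = U_ζ J U_ζ / Tr(J U - J U_ζ) + U_ζ`. -/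
def matW {m : ℕ} {κ : Type*} [Fintype κ] [DecidableEq κ] (J : Matrix κ κ ℂ) (ζ : ℝ)
    (S : AlgState m κ) : Matrix κ κ ℂ :=
  (J * resolventU J S.Γ S.u - J * resolventU J S.Γ (S.u + ζ)).trace⁻¹ •
      (resolventU J S.Γ (S.u + ζ) * J * resolventU J S.Γ (S.u + ζ))
    + resolventU J S.Γ (S.u + ζ)

/-- In state `S`, the suggested point (with function values `ax = a(x)`, `bx = b(x)`) passes the
test `a(x)^* V a(x) ≥ b(x)^* W b(x)`, and `w > 0` is an admissible weight for it, that is, `w⁻¹`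
lies between the two values (this includes the inequality of the test). -/
def Accepts {m : ℕ} {κ : Type*} [Fintype κ] [DecidableEq κ] (J : Matrix κ κ ℂ) (δ ζ : ℝ)
    (S : AlgState m κ) (ax : Fin m → ℂ) (bx : κ → ℂ) (w : ℝ) : Prop :=
  0 < w ∧ quadForm (matW J ζ S) bx ≤ w⁻¹ ∧ w⁻¹ ≤ quadForm (matV δ S) ax

/-- The update `G ← G + w a a^*`, `Γ ← Γ + w b b^*`, `ℓ ← ℓ + δ`, `u ← u + ζ`. -/
def updateState {m : ℕ} {κ : Type*} (δ ζ : ℝ)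
    (S : AlgState m κ) (ax : Fin m → ℂ) (bx : κ → ℂ) (w : ℝ) : AlgState m κ where
  G := S.G + (w : ℂ) • outer ax
  Γ := S.Γ + (w : ℂ) • outer bx
  l := S.l + δ
  u := S.u + ζ

/-- `(x_i, w_i)_{i < n}` is a possible output of the construction with input `a`, `b`, `n` and
parameters `0 < δ ≤ δ_*`, `ζ ≥ ζ_*`: there is a sequence of states, starting with the initial one,
such that in step `i` the point `x_i` is accepted with weight `w_i` and the state is updated
accordingly. The oracle that suggests the points is arbitrary; rejected suggestions leave the state
unchanged and hence leave no trace in the output. -/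
def IsOutput {D : Type*} [MeasurableSpace D] (μ : Measure D) {m : ℕ} {κ : Type*} [Fintype κ]
    [DecidableEq κ] (a : D → Fin m → ℂ) (b : D → κ → ℂ) (n : ℕ) (δ ζ : ℝ)
    (x : Fin n → D) (w : Fin n → ℝ) : Prop :=
  (0 < δ ∧ δ ≤ deltaStar m n ∧ zetaStar n (gramJ μ b) ≤ ζ) ∧
  ∃ S : Fin (n + 1) → AlgState m κ,
    S 0 = initState m n (gramJ μ b) ∧
    ∀ i : Fin n,
      Accepts (gramJ μ b) δ ζ (S i.castSucc) (a (x i)) (b (x i)) (w i) ∧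
      S i.succ = updateState δ ζ (S i.castSucc) (a (x i)) (b (x i)) (w i)

/-! ### The choice of the input for weighted least squares -/

/-- `c = m^{-t} + √( (1 / (2m)) ∑_{k=m}^{N} k^{-2t} )`. -/
def cParam (t : ℝ) (m N : ℕ) : ℝ :=
  (m : ℝ) ^ (-t) + Real.sqrt (1 / (2 * (m : ℝ)) * ∑ k ∈ Finset.Icc m N, (k : ℝ) ^ (-(2 * t)))

/-- `a = (b_0, …, b_{m-1})`. -/
def inputA {D : Type*} (b : ℕ → D → ℂ) (m : ℕ) : D → Fin m → ℂ := fun x k => b k x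

/-- `(c, k^{-t} b_k)_{m ≤ k < N}`: the constant function `c` (index `none`) followed by
the functions `k^{-t} b_k`, `m ≤ k < N`. -/
def inputB {D : Type*} (b : ℕ → D → ℂ) (t : ℝ) (m N : ℕ) :
    D → Option {k : ℕ // k ∈ Finset.Ico m N} → ℂ
  | _, none => ((cParam t m N : ℝ) : ℂ)
  | x, some k => (((k.1 : ℝ) ^ (-t) : ℝ) : ℂ) * b k.1 x

/-- The `2m` points `x_i` and weights `w_i` are a possible output of the construction for
`n = 2m`, `a = (b_0, …, b_{m-1})`, `(c, k^{-t} b_k)_{m ≤ k < N}` and `(δ, ζ) = (δ_*, ζ_*)`. -/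
def IsLeastSquaresDesign {D : Type*} [MeasurableSpace D] (μ : Measure D) (b : ℕ → D → ℂ)
    (t : ℝ) (m N : ℕ) (x : Fin (2 * m) → D) (w : Fin (2 * m) → ℝ) : Prop :=
  IsOutput μ (inputA b m) (inputB b t m N) (2 * m) (deltaStar m (2 * m))
    (zetaStar (2 * m) (gramJ μ (inputB b t m N))) x w

end WLS

end

/-! The points come from a two-sided barrier argument. The lower potential Tr (G - ℓI)⁻¹ keeps the
spectrum of G above ℓ, and the upper potential Tr J(uJ - Γ)⁻¹ keeps Γ below uJ. Moving the barriers
by δ and ζ raises the lower potential and lowers the upper one. By Sherman–Morrison, the two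
inequalities for w⁻¹ say that the rank-one update at least undoes the rise and at most uses up the
drop, so neither potential ever exceeds its initial value Φ or Ψ (`AlgState.Feasible.update`). On
average over μ, the form of V is at least 1/δ - Φ and the form of W is at most 1/ζ + Ψ. For the
prescribed parameters these numbers are n + 1 and n (`potential_lt`), so some point passes the test
in every step.

After n = 2m steps, the lower barrier gives a discrete lower frame bound on V_m, at least 1/50 for m
≥ 2 (`le_frameConst`). The upper barrier bounds ∑ w_i b(x_i) b(x_i)^* by 9c², where c is of order
m^{-t} because t > 1/2 (`IsLeastSquaresDesign.spectral`, `exists_cParam_le`). Tested on the constant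
entry it gives ∑ w_i ≤ 9. Tested on the others it controls the discrete norm of the Fourier block m
≤ k < N by c² ∑ k^{2t}|f_k|², which is of order m^{-2α} log^{2β} m because t < α.

Let P be the m-th Fourier partial sum of f. The residual f - P consists of that block and of the
tail beyond K = max(N, m). Dyadic blocks and hypothesis (1) bound the tail uniformly by a multiple
of K^{-(α-θ)} log^β K (`exists_norm_sub_partialSum_le`). The size of N makes this at most a multiple
of m^{-α} log^β m (`exists_decay_le`), and ∑ w_i ≤ 9 carries it over to the discrete norm. Least
squares is a projection in the discrete norm, so A_m f - P is controlled there by f - P, and the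
frame bound returns to L₂. Applying (1) on V_m costs m^θ and gives the uniform bound; the other p
follow by monotonicity or interpolation. -/

namespace WLS

open Matrix
open scoped ComplexOrder

/-! ### Quadratic forms and traces of complex matrices -/

section QuadForm

variable {κ : Type*} [Fintype κ]

lemma quadForm_add (M N : Matrix κ κ ℂ) (v : κ → ℂ) :
    quadForm (M + N) v = quadForm M v + quadForm N v := by
  simp [quadForm, add_mulVec, dotProduct_add]

lemma quadForm_sub (M N : Matrix κ κ ℂ) (v : κ → ℂ) :
    quadForm (M - N) v = quadForm M v - quadForm N v := by
  simp [quadForm, sub_mulVec, dotProduct_sub]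

lemma quadForm_smul (r : ℝ) (M : Matrix κ κ ℂ) (v : κ → ℂ) :
    quadForm ((r : ℂ) • M) v = r * quadForm M v := by
  simp [quadForm, smul_mulVec, dotProduct_smul]

lemma quadForm_sum {ι : Type*} (s : Finset ι) (M : ι → Matrix κ κ ℂ) (v : κ → ℂ) :
    quadForm (∑ i ∈ s, M i) v = ∑ i ∈ s, quadForm (M i) v := by
  classical
  induction s using Finset.induction_on with
  | empty => simp [quadForm]
  | insert a s ha ih => rw [Finset.sum_insert ha, Finset.sum_insert ha, quadForm_add, ih]

lemma quadForm_outer (b v : κ → ℂ) : quadForm (outer b) v = ‖star v ⬝ᵥ b‖ ^ 2 := by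
  have h : star v ⬝ᵥ (outer b *ᵥ v) = (star v ⬝ᵥ b) * star (star v ⬝ᵥ b) := by
    rw [outer, vecMulVec_mulVec, dotProduct_smul, star_dotProduct b v]
    simp
  rw [quadForm, h, Complex.star_def, Complex.mul_conj, Complex.normSq_eq_norm_sq]
  norm_cast

lemma quadForm_diagonal [DecidableEq κ] (d : κ → ℝ) (v : κ → ℂ) :
    quadForm (diagonal fun i => (d i : ℂ)) v = ∑ i, d i * ‖v i‖ ^ 2 := by
  simp only [quadForm, dotProduct, mulVec_diagonal, Complex.re_sum, Pi.star_apply]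
  refine Finset.sum_congr rfl fun i _ => ?_
  have : star (v i) * (d i * v i) = ((d i * ‖v i‖ ^ 2 : ℝ) : ℂ) := by
    push_cast
    rw [← Complex.mul_conj']
    simp only [Complex.star_def]; ring
  rw [this, Complex.ofReal_re]

lemma quadForm_one [DecidableEq κ] (v : κ → ℂ) :
    quadForm (1 : Matrix κ κ ℂ) v = ∑ i, ‖v i‖ ^ 2 := by
  have := quadForm_diagonal (fun _ : κ => (1 : ℝ)) v
  simpa using this

lemma trace_mul_outer (M : Matrix κ κ ℂ) (v : κ → ℂ) :
    (M * outer v).trace = star v ⬝ᵥ (M *ᵥ v) := by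
  rw [outer, mul_vecMulVec, trace_vecMulVec, dotProduct_comm]

lemma _root_.Matrix.IsHermitian.star_dotProduct_mulVec {M : Matrix κ κ ℂ} (hM : M.IsHermitian)
    (v : κ → ℂ) : star v ⬝ᵥ (M *ᵥ v) = (quadForm M v : ℂ) := by
  have h : star (star v ⬝ᵥ (M *ᵥ v)) = star v ⬝ᵥ (M *ᵥ v) := by
    rw [← star_dotProduct_star, star_star, star_mulVec, hM.eq,
      ← dotProduct_mulVec]
  apply Complex.ext
  · simp [quadForm]
  · rw [Complex.ofReal_im]
    exact Complex.conj_eq_iff_im.1 h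

lemma _root_.Matrix.IsHermitian.posDef_of_quadForm_pos {M : Matrix κ κ ℂ} (hM : M.IsHermitian)
    (h : ∀ v, v ≠ 0 → 0 < quadForm M v) : M.PosDef :=
  PosDef.of_dotProduct_mulVec_pos hM fun v hv => by
    rw [hM.star_dotProduct_mulVec]
    exact_mod_cast h v hv

lemma _root_.Matrix.PosDef.quadForm_pos {M : Matrix κ κ ℂ} (hM : M.PosDef) {v : κ → ℂ}
    (hv : v ≠ 0) : 0 < quadForm M v :=
  hM.re_dotProduct_pos hv

lemma _root_.Matrix.PosSemidef.quadForm_nonneg {M : Matrix κ κ ℂ} (hM : M.PosSemidef)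
    (v : κ → ℂ) : 0 ≤ quadForm M v :=
  hM.re_dotProduct_nonneg v

lemma _root_.Matrix.IsHermitian.trace_eq_ofReal_re {M : Matrix κ κ ℂ} (hM : M.IsHermitian) :
    M.trace = (M.trace.re : ℂ) := by
  apply Complex.ext
  · simp
  · have h : star M.trace = M.trace := by rw [← trace_conjTranspose, hM.eq]
    rw [Complex.ofReal_im]
    exact Complex.conj_eq_iff_im.1 h

open scoped MatrixOrder in
lemma _root_.Matrix.PosSemidef.exists_eq_conjTranspose_mul {M : Matrix κ κ ℂ}
    (hM : M.PosSemidef) : ∃ B : Matrix κ κ ℂ, M = Bᴴ * B := by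
  classical
  obtain ⟨B, hB⟩ := CStarAlgebra.nonneg_iff_eq_star_mul_self.1 hM.nonneg
  exact ⟨B, hB⟩

lemma _root_.Matrix.PosSemidef.trace_mul_nonneg {P Q : Matrix κ κ ℂ} (hP : P.PosSemidef)
    (hQ : Q.PosSemidef) : 0 ≤ (P * Q).trace := by
  obtain ⟨B, rfl⟩ := hQ.exists_eq_conjTranspose_mul
  rw [← mul_assoc, trace_mul_comm, ← mul_assoc]
  exact (hP.mul_mul_conjTranspose_same B).trace_nonneg

/-- Factor Q = B^* B and cycle the trace to that of B P B^*. Since Q is invertible, so is B, and the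
congruence stays definite. -/
lemma _root_.Matrix.PosDef.trace_mul_pos [Nonempty κ] {P Q : Matrix κ κ ℂ} (hP : P.PosDef)
    (hQ : Q.PosDef) : 0 < (P * Q).trace := by
  classical
  obtain ⟨B, rfl⟩ := hQ.posSemidef.exists_eq_conjTranspose_mul
  have hB : IsUnit B := by
    have := hQ.isUnit
    rw [isUnit_iff_isUnit_det, det_mul] at this
    exact (isUnit_iff_isUnit_det _).2 (isUnit_of_mul_isUnit_right this)
  rw [← mul_assoc, trace_mul_comm, ← mul_assoc]
  exact (hP.mul_mul_conjTranspose_same (vecMul_injective_of_isUnit hB)).trace_pos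

/-- For M = B^* B the form is ‖Bv‖² and the trace is the squared Hilbert–Schmidt norm of B;
Cauchy–Schwarz in each row does the rest. It stands in for "largest eigenvalue ≤ trace". -/
lemma _root_.Matrix.PosSemidef.quadForm_le_trace_mul {M : Matrix κ κ ℂ} (hM : M.PosSemidef)
    (v : κ → ℂ) : quadForm M v ≤ M.trace.re * ∑ i, ‖v i‖ ^ 2 := by
  obtain ⟨B, rfl⟩ := hM.exists_eq_conjTranspose_mul
  have h1 : quadForm (Bᴴ * B) v = ∑ i, ‖(B *ᵥ v) i‖ ^ 2 := by
    rw [quadForm, ← mulVec_mulVec, dotProduct_mulVec, vecMul_conjTranspose, star_star,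
      dotProduct, Complex.re_sum]
    refine Finset.sum_congr rfl fun i _ => ?_
    rw [Pi.star_apply, Complex.star_def, Complex.conj_mul']
    norm_cast
  have h2 : (Bᴴ * B).trace.re = ∑ i, ∑ j, ‖B i j‖ ^ 2 := by
    simp only [trace, diag_apply, mul_apply, Complex.re_sum, conjTranspose_apply]
    rw [Finset.sum_comm]
    refine Finset.sum_congr rfl fun i _ => Finset.sum_congr rfl fun j _ => ?_
    rw [Complex.star_def, Complex.conj_mul']
    norm_cast
  rw [h1, h2, Finset.sum_mul]
  refine Finset.sum_le_sum fun i _ => ?_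
  calc ‖(B *ᵥ v) i‖ ^ 2 ≤ (∑ j, ‖B i j‖ * ‖v j‖) ^ 2 := by
        gcongr
        refine (norm_sum_le _ _).trans (le_of_eq ?_)
        simp
    _ ≤ _ := Finset.sum_mul_sq_le_sq_mul_sq _ _ _

end QuadForm

/-! ### Rank-one updates -/

section RankOne

variable {κ : Type*} [Fintype κ] [DecidableEq κ]

/-- The **Sherman–Morrison formula** for Hermitian matrices. -/
lemma inv_add_smul_outer {A : Matrix κ κ ℂ} (hA : A.IsHermitian) (hu : IsUnit A) (w : ℝ)
    (v : κ → ℂ) (hw : 1 + w * quadForm A⁻¹ v ≠ 0) :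
    (A + (w : ℂ) • outer v) *
      (A⁻¹ - ((w / (1 + w * quadForm A⁻¹ v) : ℝ) : ℂ) • outer (A⁻¹ *ᵥ v)) = 1 := by
  have hd : IsUnit A.det := (isUnit_iff_isUnit_det _).1 hu
  have hq := hA.inv.star_dotProduct_mulVec v
  set q := quadForm A⁻¹ v
  have hs : star (A⁻¹ *ᵥ v) = star v ᵥ* A⁻¹ := by rw [star_mulVec, hA.inv.eq]
  have e1 : A * outer (A⁻¹ *ᵥ v) = vecMulVec v (star v ᵥ* A⁻¹) := by
    rw [outer, mul_vecMulVec, mulVec_mulVec, mul_nonsing_inv _ hd, one_mulVec, hs]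
  have e2 : outer v * A⁻¹ = vecMulVec v (star v ᵥ* A⁻¹) := by rw [outer, vecMulVec_mul]
  have e3 : outer v * outer (A⁻¹ *ᵥ v) = (q : ℂ) • vecMulVec v (star v ᵥ* A⁻¹) := by
    rw [outer, outer, vecMulVec_mul_vecMulVec, hq, hs, vecMulVec_smul]
  rw [mul_sub, add_mul, add_mul, mul_nonsing_inv _ hd, smul_mul_assoc, e2, mul_smul_comm, e1,
    smul_mul_assoc, mul_smul_comm, e3, smul_smul, smul_smul]
  have : (w : ℂ) - ((w / (1 + w * q) : ℝ) : ℂ) - (w : ℂ) * (((w / (1 + w * q) : ℝ) : ℂ) * q) = 0 := by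
    norm_cast
    field_simp
    ring
  calc _ = 1 + ((w : ℂ) - ((w / (1 + w * q) : ℝ) : ℂ) - (w : ℂ) * (((w / (1 + w * q) : ℝ) : ℂ) * q))
        • vecMulVec v (star v ᵥ* A⁻¹) := by
        module
    _ = 1 := by rw [this, zero_smul, add_zero]

/-- Describes how an update moves a potential: the lower one with J = 1 and weight w, the upper one
with weight -w. -/
lemma trace_mul_inv_add_smul_outer {A : Matrix κ κ ℂ} (hA : A.IsHermitian) (hu : IsUnit A) (w : ℝ)
    (v : κ → ℂ) (hw : 1 + w * quadForm A⁻¹ v ≠ 0) (J : Matrix κ κ ℂ) :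
    (J * (A + (w : ℂ) • outer v)⁻¹).trace.re =
      (J * A⁻¹).trace.re - w / (1 + w * quadForm A⁻¹ v) * quadForm (A⁻¹ * J * A⁻¹) v := by
  rw [inv_eq_right_inv (inv_add_smul_outer hA hu w v hw), mul_sub, trace_sub, Complex.sub_re,
    mul_smul_comm, trace_smul, trace_mul_outer, smul_eq_mul, Complex.re_ofReal_mul]
  congr 2
  rw [quadForm, star_mulVec, hA.inv.eq, ← dotProduct_mulVec, mulVec_mulVec, mulVec_mulVec]

omit [DecidableEq κ] in
lemma _root_.Matrix.PosDef.add_smul_outer {A : Matrix κ κ ℂ} (hA : A.PosDef) {w : ℝ} (hw : 0 ≤ w)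
    (v : κ → ℂ) : (A + (w : ℂ) • outer v).PosDef :=
  hA.add_posSemidef ((posSemidef_vecMulVec_self_star v).smul (by exact_mod_cast hw))

/-- Sherman–Morrison with weight -w exhibits the inverse as A⁻¹ plus a nonnegative rank-one matrix.
That is positive definite, and so is its own inverse. -/
lemma _root_.Matrix.PosDef.sub_smul_outer {A : Matrix κ κ ℂ} (hA : A.PosDef) {w : ℝ} (hw : 0 ≤ w)
    {v : κ → ℂ} (hq : w * quadForm A⁻¹ v < 1) : (A - (w : ℂ) • outer v).PosDef := by
  have h := inv_add_smul_outer hA.1 hA.isUnit (-w) v (by nlinarith)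
  have hP : (A⁻¹ - ((-w / (1 + -w * quadForm A⁻¹ v) : ℝ) : ℂ) • outer (A⁻¹ *ᵥ v)).PosDef := by
    have : -w / (1 + -w * quadForm A⁻¹ v) = -(w / (1 - w * quadForm A⁻¹ v)) := by ring
    rw [this, Complex.ofReal_neg, neg_smul, sub_neg_eq_add]
    exact hA.inv.add_smul_outer (div_nonneg hw (by linarith)) _
  have e : A + ((-w : ℝ) : ℂ) • outer v = A - (w : ℂ) • outer v := by
    rw [Complex.ofReal_neg, neg_smul, sub_eq_add_neg]
  rw [e] at h
  rw [← inv_eq_left_inv h]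
  exact hP.inv

end RankOne

end WLS

namespace WLS

open Matrix
open scoped ComplexOrder

/-! ### The lower barrier -/

section LowerBarrier

variable {κ : Type*} [Fintype κ] [DecidableEq κ]

/-- If `δ Tr(A⁻¹) < 1`, then the lower barrier can be shifted by `δ`. -/
lemma _root_.Matrix.PosDef.sub_smul_one {A : Matrix κ κ ℂ} (hA : A.PosDef) {δ : ℝ} (hδ : 0 < δ)
    (h : δ * (A⁻¹).trace.re < 1) : (A - (δ : ℂ) • (1 : Matrix κ κ ℂ)).PosDef := by
  have hd : IsUnit A.det := (isUnit_iff_isUnit_det _).1 hA.isUnit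
  have hH : (A - (δ : ℂ) • (1 : Matrix κ κ ℂ)).IsHermitian :=
    hA.1.sub (by simp [IsHermitian, conjTranspose_smul])
  refine hH.posDef_of_quadForm_pos fun v hv => ?_
  -- Completing the square gives A - δ ≥ δ(1 - δA⁻¹), and the right side is positive because A⁻¹ ≤
  -- Tr(A⁻¹).
  have e : (1 - (δ : ℂ) • A⁻¹)ᴴ * A * (1 - (δ : ℂ) • A⁻¹) =
      A - ((2 * δ : ℝ) : ℂ) • (1 : Matrix κ κ ℂ) + ((δ ^ 2 : ℝ) : ℂ) • A⁻¹ := by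
    simp only [conjTranspose_sub, conjTranspose_one, conjTranspose_smul, hA.inv.1.eq,
      Complex.star_def, Complex.conj_ofReal, sub_mul, mul_sub, one_mul, mul_one, smul_mul_assoc,
      mul_smul_comm, mul_nonsing_inv _ hd, nonsing_inv_mul _ hd]
    push_cast
    module
  have h0 := (hA.posSemidef.conjTranspose_mul_mul_same (1 - (δ : ℂ) • A⁻¹)).quadForm_nonneg v
  rw [e, quadForm_add, quadForm_sub, quadForm_smul, quadForm_smul, quadForm_one] at h0
  have h1 := hA.inv.posSemidef.quadForm_le_trace_mul v
  have hp : 0 < ∑ i, ‖v i‖ ^ 2 := by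
    obtain ⟨i, hi⟩ := Function.ne_iff.1 hv
    exact Finset.sum_pos' (fun _ _ => by positivity) ⟨i, Finset.mem_univ _, by
      have : 0 < ‖v i‖ := norm_pos_iff.2 hi
      positivity⟩
  rw [quadForm_sub, quadForm_smul, quadForm_one]
  set S := ∑ i, ‖v i‖ ^ 2
  have h2 : δ * (δ * (A⁻¹).trace.re * S) < δ * (1 * S) := by gcongr
  nlinarith [mul_le_mul_of_nonneg_left h1 (sq_nonneg δ)]

/-- Basic trace estimates for the lower barrier shift from `A + δ` to `A`. -/
lemma trace_lower_barrier {A B : Matrix κ κ ℂ} (hA : A.PosDef) (hB : B.PosDef) {δ : ℝ}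
    (hδ : 0 < δ) (hAB : B = A + (δ : ℂ) • (1 : Matrix κ κ ℂ)) (h : δ * (B⁻¹).trace.re ≤ 1)
    [Nonempty κ] :
    0 < (A⁻¹ - B⁻¹).trace.re ∧
      (δ⁻¹ - (B⁻¹).trace.re) ≤
        ((A⁻¹ - B⁻¹).trace.re)⁻¹ * (A⁻¹ ^ 2).trace.re - (A⁻¹).trace.re := by
  have hA' : IsUnit A.det := (isUnit_iff_isUnit_det _).1 hA.isUnit
  have hB' : IsUnit B.det := (isUnit_iff_isUnit_det _).1 hB.isUnit
  set X := A⁻¹ with hX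
  set Y := B⁻¹ with hY
  have e1 : X - Y = (δ : ℂ) • (X * Y) := by
    rw [hX, hY, inv_sub_inv ⟨fun _ => hB.isUnit, fun _ => hA.isUnit⟩, hAB, add_sub_cancel_left,
      mul_smul_comm, mul_one, smul_mul_assoc]
  have e2 : X - Y = (δ : ℂ) • (Y * X) := by
    have : Y - X = Y * (A - B) * X := by
      rw [hX, hY, inv_sub_inv ⟨fun _ => hA.isUnit, fun _ => hB.isUnit⟩]
    rw [← neg_sub, this, hAB, sub_add_cancel_left, mul_neg, neg_mul, neg_neg,
      mul_smul_comm, mul_one, smul_mul_assoc]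
  have hS : 0 < (X * Y).trace.re := (Complex.pos_iff.1 (hA.inv.trace_mul_pos hB.inv)).1
  have e3 : (X - Y).trace.re = δ * (X * Y).trace.re := by
    rw [e1, trace_smul, smul_eq_mul, Complex.re_ofReal_mul]
  have e4 : (X ^ 2).trace.re - (X * Y).trace.re = δ * (X * Y * X).trace.re := by
    have : X ^ 2 - X * Y = (δ : ℂ) • (X * Y * X) := by
      rw [pow_two, ← mul_sub, e2, mul_smul_comm, mul_assoc]
    rw [← Complex.sub_re, ← trace_sub, this, trace_smul, smul_eq_mul, Complex.re_ofReal_mul]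
  set S := (X * Y).trace.re
  set T := (X * Y * X).trace.re
  -- Everything reduces to T ≥ δS². Positivity of Tr (X - τ)Y(X - τ) is a quadratic inequality in τ;
  -- at τ = δS = Tr(X - Y) the hypothesis δ Tr Y ≤ 1 turns it into this bound.
  set τ := δ * S
  have h0 : 0 ≤ T - 2 * τ * S + τ ^ 2 * Y.trace.re := by
    have h1 := (hB.inv.posSemidef.conjTranspose_mul_mul_same (X - (τ : ℂ) • 1)).trace_nonneg
    have e : (X - (τ : ℂ) • 1)ᴴ * Y * (X - (τ : ℂ) • 1) =
        X * Y * X - (τ : ℂ) • (X * Y) - (τ : ℂ) • (Y * X) + ((τ ^ 2 : ℝ) : ℂ) • Y := by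
      simp only [conjTranspose_sub, conjTranspose_one, conjTranspose_smul, hA.inv.1.eq, hX,
        Complex.star_def, Complex.conj_ofReal, sub_mul, mul_sub, one_mul, mul_one, smul_mul_assoc,
        mul_smul_comm]
      push_cast
      module
    rw [← hY, e] at h1
    have h2 := (Complex.nonneg_iff.1 h1).1
    simp only [trace_add, trace_sub, trace_smul, smul_eq_mul, Complex.add_re, Complex.sub_re,
      Complex.re_ofReal_mul, trace_mul_comm Y X] at h2
    linarith
  have hT : δ * S ^ 2 ≤ T := by
    have : τ ^ 2 * Y.trace.re = (δ * S ^ 2) * (δ * Y.trace.re) := by ring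
    have : τ ^ 2 * Y.trace.re ≤ (δ * S ^ 2) * 1 := by
      rw [this]; gcongr
    have : τ * S = δ * S ^ 2 := by ring
    linarith
  have e5 : X.trace.re = Y.trace.re + δ * S := by
    have : X.trace.re - Y.trace.re = δ * S := by rw [← Complex.sub_re, ← trace_sub]; exact e3
    linarith
  refine ⟨by rw [e3]; positivity, ?_⟩
  have e6 : (X ^ 2).trace.re = S + δ * T := by linarith
  rw [e3, e6, e5]
  have : (δ * S)⁻¹ * (S + δ * T) = δ⁻¹ + T / S := by field_simp
  have h3 : δ * S ≤ T / S := by rw [le_div_iff₀ hS]; linarith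
  rw [this]
  linarith

/-- Adding `w v v^*` with `w⁻¹ ≤ v^* V v` does not let the lower potential grow. -/
lemma trace_inv_add_smul_outer_le {A B : Matrix κ κ ℂ} (hA : A.PosDef) {w : ℝ} (hw : 0 < w)
    {v : κ → ℂ} (hT : 0 < (A⁻¹ - B⁻¹).trace.re)
    (h : w⁻¹ ≤ ((A⁻¹ - B⁻¹).trace.re)⁻¹ * quadForm (A⁻¹ ^ 2) v - quadForm A⁻¹ v) :
    ((A + (w : ℂ) • outer v)⁻¹).trace.re ≤ (B⁻¹).trace.re := by
  have hq : 0 ≤ quadForm A⁻¹ v := hA.inv.posSemidef.quadForm_nonneg v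
  have h1 : 0 < 1 + w * quadForm A⁻¹ v := by positivity
  have e := trace_mul_inv_add_smul_outer hA.1 hA.isUnit w v h1.ne' 1
  rw [one_mul, one_mul, mul_one, ← pow_two] at e
  rw [e]
  rw [trace_sub, Complex.sub_re] at hT h
  set T := (A⁻¹).trace.re - (B⁻¹).trace.re with hTd
  have h2 : T * (w⁻¹ + quadForm A⁻¹ v) ≤ quadForm (A⁻¹ ^ 2) v := by
    have : T * (w⁻¹ + quadForm A⁻¹ v) ≤ T * (T⁻¹ * quadForm (A⁻¹ ^ 2) v) := by
      gcongr; linarith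
    rwa [mul_inv_cancel_left₀ hT.ne'] at this
  -- The factor w/(1 + wq) is 1/(w⁻¹ + q), so the test says exactly that the update lowers the
  -- potential by at least T, the amount by which the shift raised it.
  have h3 : T ≤ w / (1 + w * quadForm A⁻¹ v) * quadForm (A⁻¹ ^ 2) v := by
    calc T = w / (1 + w * quadForm A⁻¹ v) * (T * (w⁻¹ + quadForm A⁻¹ v)) := by
          field_simp
      _ ≤ _ := by gcongr
  linarith

end LowerBarrier

/-! ### The upper barrier -/

section UpperBarrier

variable {κ : Type*} [Fintype κ] [DecidableEq κ] [Nonempty κ]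

/-- Basic trace estimates for the upper barrier shift from `A` to `B = A + ζ J`. -/
lemma trace_upper_barrier {A B J : Matrix κ κ ℂ} (hA : A.PosDef) (hJ : J.PosDef) {ζ : ℝ}
    (hζ : 0 < ζ) (hAB : B = A + (ζ : ℂ) • J) :
    B.PosDef ∧ 0 < (J * A⁻¹ - J * B⁻¹).trace ∧
      ((J * A⁻¹ - J * B⁻¹).trace.re)⁻¹ * (J * (B⁻¹ * J * B⁻¹)).trace.re + (J * B⁻¹).trace.re ≤
        ζ⁻¹ + (J * A⁻¹).trace.re := by
  have hζ' : (0 : ℂ) < ζ := by exact_mod_cast hζ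
  have hB : B.PosDef := by
    rw [hAB]; exact hA.add_posSemidef (hJ.posSemidef.smul hζ'.le)
  set X := A⁻¹ with hX
  set Y := B⁻¹ with hY
  have e1 : X - Y = (ζ : ℂ) • (X * J * Y) := by
    rw [hX, hY, inv_sub_inv ⟨fun _ => hB.isUnit, fun _ => hA.isUnit⟩, hAB, add_sub_cancel_left,
      mul_smul_comm, smul_mul_assoc]
  have e2 : X - Y = (ζ : ℂ) • (Y * J * X) := by
    have : Y - X = Y * (A - B) * X := by
      rw [hX, hY, inv_sub_inv ⟨fun _ => hA.isUnit, fun _ => hB.isUnit⟩]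
    rw [← neg_sub, this, hAB, sub_add_cancel_left, mul_neg, neg_mul, neg_neg,
      mul_smul_comm, smul_mul_assoc]
  have hXP : X.PosDef := hA.inv
  have hYP : Y.PosDef := hB.inv
  have hJi : Function.Injective J.vecMul := vecMul_injective_of_isUnit hJ.isUnit
  have hJXJ : (J * X * J).PosDef := by
    simpa [hJ.1.eq] using hXP.mul_mul_conjTranspose_same (B := J) hJi
  have e3 : J * X - J * Y = (ζ : ℂ) • (J * X * J * Y) := by
    rw [← mul_sub, e1, mul_smul_comm, mul_assoc, mul_assoc, mul_assoc]
  have hpos : 0 < (J * X * J * Y).trace := hJXJ.trace_mul_pos hYP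
  have hT : 0 < (J * X - J * Y).trace := by
    rw [e3, trace_smul, smul_eq_mul]
    exact mul_pos hζ' hpos
  have hT' : 0 < (J * X - J * Y).trace.re := (Complex.pos_iff.1 hT).1
  refine ⟨hB, hT, ?_⟩
  -- Inserting the resolvent identity into itself writes X - Y as ζYJY + ζ²Y(JXJ)Y, a sum of
  -- congruences of positive matrices.
  have hPSD : (X - Y).PosSemidef := by
    have e4 : X - Y = (ζ : ℂ) • (Y * J * Y) + ((ζ : ℂ) ^ 2) • (Y * (J * X * J) * Y) := by
      calc X - Y = (ζ : ℂ) • (Y * J * (Y + (X - Y))) := by rw [add_sub_cancel, ← e2]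
        _ = _ := by
          rw [e1]
          simp only [mul_add, mul_smul_comm, smul_add, smul_smul, pow_two, mul_assoc]
    rw [e4]
    have a1 : (Y * J * Y).PosSemidef := by
      simpa [hYP.1.eq] using hJ.posSemidef.mul_mul_conjTranspose_same Y
    have a2 : (Y * (J * X * J) * Y).PosSemidef := by
      simpa [hYP.1.eq] using hJXJ.posSemidef.mul_mul_conjTranspose_same Y
    exact (a1.smul hζ'.le).add (a2.smul (pow_nonneg hζ'.le 2))
  have hPJ : (J * (X - Y) * J).PosSemidef := by
    simpa [hJ.1.eq] using hPSD.mul_mul_conjTranspose_same J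
  have h1 : (J * (Y * J * Y)).trace.re ≤ (J * X * J * Y).trace.re := by
    have := (Complex.nonneg_iff.1 (hPJ.trace_mul_nonneg hYP.posSemidef)).1
    rw [mul_sub, sub_mul, sub_mul, trace_sub, Complex.sub_re] at this
    have e : J * (Y * J * Y) = J * Y * J * Y := by simp only [mul_assoc]
    rw [e]; linarith
  have e5 : (J * X - J * Y).trace.re = ζ * (J * X * J * Y).trace.re := by
    rw [e3, trace_smul, smul_eq_mul, Complex.re_ofReal_mul]
  have hR : 0 < (J * X * J * Y).trace.re := (Complex.pos_iff.1 hpos).1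
  have h2 : ((J * X - J * Y).trace.re)⁻¹ * (J * (Y * J * Y)).trace.re ≤ ζ⁻¹ := by
    rw [e5, mul_inv, mul_assoc]
    refine mul_le_of_le_one_right (by positivity) ?_
    rw [inv_mul_le_iff₀ hR]; linarith
  rw [trace_sub, Complex.sub_re] at hT'
  linarith

omit [Nonempty κ] in
/-- Subtracting `w v v^*` with `v^* W v ≤ w⁻¹` preserves positivity and does not let the upper
potential grow. -/
lemma posDef_sub_smul_outer_and_trace_le {A B J : Matrix κ κ ℂ} (hB : B.PosDef) (hJ : J.PosDef)
    {w : ℝ} (hw : 0 < w) {v : κ → ℂ} (hT : 0 < (J * A⁻¹ - J * B⁻¹).trace.re)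
    (h : ((J * A⁻¹ - J * B⁻¹).trace.re)⁻¹ * quadForm (B⁻¹ * J * B⁻¹) v + quadForm B⁻¹ v ≤ w⁻¹) :
    (B - (w : ℂ) • outer v).PosDef ∧
      (J * (B - (w : ℂ) • outer v)⁻¹).trace.re ≤ (J * A⁻¹).trace.re := by
  have hBJB : (B⁻¹ * J * B⁻¹).PosDef := by
    simpa [hB.inv.1.eq] using
      hJ.mul_mul_conjTranspose_same (B := B⁻¹) (vecMul_injective_of_isUnit hB.inv.isUnit)
  -- Strictness comes from the first term of W, which is positive for v ≠ 0; without it the update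
  -- could reach the barrier.
  have hlt : w * quadForm B⁻¹ v < 1 := by
    by_cases hv : v = 0
    · simp [hv, quadForm]
    · have h1 := hBJB.quadForm_pos hv
      have h2 : quadForm B⁻¹ v < w⁻¹ := by
        have : 0 < ((J * A⁻¹ - J * B⁻¹).trace.re)⁻¹ * quadForm (B⁻¹ * J * B⁻¹) v := by positivity
        linarith
      calc w * quadForm B⁻¹ v < w * w⁻¹ := by gcongr
        _ = 1 := mul_inv_cancel₀ hw.ne'
  refine ⟨hB.sub_smul_outer hw.le hlt, ?_⟩
  have h1 : 0 < 1 - w * quadForm B⁻¹ v := by linarith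
  have e := trace_mul_inv_add_smul_outer hB.1 hB.isUnit (-w) v (by linarith) J
  have e' : B + ((-w : ℝ) : ℂ) • outer v = B - (w : ℂ) • outer v := by
    rw [Complex.ofReal_neg, neg_smul, sub_eq_add_neg]
  rw [e'] at e
  rw [e]
  rw [trace_sub, Complex.sub_re] at hT h
  set T := (J * A⁻¹).trace.re - (J * B⁻¹).trace.re with hTd
  set Q := quadForm (B⁻¹ * J * B⁻¹) v
  have h2 : Q ≤ T * (w⁻¹ - quadForm B⁻¹ v) := by
    have : T * (T⁻¹ * Q) ≤ T * (w⁻¹ - quadForm B⁻¹ v) := by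
      gcongr; linarith
    rwa [mul_inv_cancel_left₀ hT.ne'] at this
  have h3 : w / (1 - w * quadForm B⁻¹ v) * Q ≤ T := by
    calc w / (1 - w * quadForm B⁻¹ v) * Q
        ≤ w / (1 - w * quadForm B⁻¹ v) * (T * (w⁻¹ - quadForm B⁻¹ v)) := by gcongr
      _ = T := by field_simp
  have e6 : -w / (1 + -w * quadForm B⁻¹ v) = -(w / (1 - w * quadForm B⁻¹ v)) := by ring
  rw [e6]
  linarith

end UpperBarrier

end WLS

namespace WLS

open Matrix
open scoped ComplexOrder

/-! ### Averages of quadratic forms -/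

section Integral

variable {D : Type*} [MeasurableSpace D] {μ : Measure D} {κ : Type*} [Fintype κ]

lemma quadForm_eq_sum (M : Matrix κ κ ℂ) (v : κ → ℂ) :
    quadForm M v = (∑ i, ∑ j, M i j * outer v j i).re := by
  simp only [quadForm, dotProduct, mulVec, outer, vecMulVec_apply, Finset.mul_sum]
  congr 1
  refine Finset.sum_congr rfl fun i _ => Finset.sum_congr rfl fun j _ => ?_
  ring

omit [Fintype κ] in
lemma integrable_outer {b : D → κ → ℂ} (hb : ∀ i, MemLp (fun x => b x i) 2 μ) (i j : κ) :
    Integrable (fun x => outer (b x) i j) μ := by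
  simp only [outer, vecMulVec_apply, Pi.star_apply]
  exact (hb i).integrable_mul (hb j).star

lemma integrable_quadForm {b : D → κ → ℂ} (hb : ∀ i, MemLp (fun x => b x i) 2 μ)
    (M : Matrix κ κ ℂ) : Integrable (fun x => quadForm M (b x)) μ := by
  simp only [quadForm_eq_sum]
  exact (integrable_finsetSum _ fun i _ => integrable_finsetSum _ fun j _ =>
    (integrable_outer hb j i).const_mul _).re

/-- The form is linear in the entries of v v^*, whose averages are the Gram matrix. Trace estimates
thereby become statements about the average point. -/
lemma integral_quadForm {b : D → κ → ℂ} (hb : ∀ i, MemLp (fun x => b x i) 2 μ)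
    (M : Matrix κ κ ℂ) : ∫ x, quadForm M (b x) ∂μ = (M * gramJ μ b).trace.re := by
  have h1 : ∀ i j, Integrable (fun x => M i j * outer (b x) j i) μ := fun i j =>
    (integrable_outer hb j i).const_mul _
  have h2 : ∀ i, Integrable (fun x => ∑ j, M i j * outer (b x) j i) μ := fun i =>
    integrable_finsetSum _ fun j _ => h1 i j
  simp only [quadForm_eq_sum]
  have := integral_re (𝕜 := ℂ) (integrable_finsetSum Finset.univ fun i _ => h2 i)
  simp only [RCLike.re_to_complex] at this
  rw [this, integral_finsetSum _ fun i _ => h2 i]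
  simp only [trace, diag_apply, mul_apply]
  congr 1
  refine Finset.sum_congr rfl fun i _ => ?_
  rw [integral_finsetSum _ fun j _ => h1 i j]
  refine Finset.sum_congr rfl fun j _ => ?_
  rw [integral_const_mul]
  rfl

end Integral

/-! ### The invariant and a single step -/

section Invariant

variable {m : ℕ} {κ : Type*} [Fintype κ] [DecidableEq κ]

/-- The invariant of the construction: both barriers are respected, and the lower and the upper
potential are at most `Φ` and `Ψ`. -/
structure AlgState.Feasible (J : Matrix κ κ ℂ) (Φ Ψ : ℝ) (S : AlgState m κ) : Prop where
  lower : (S.G - (S.l : ℂ) • (1 : Matrix (Fin m) (Fin m) ℂ)).PosDef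
  lower_le : (resolventL S.G S.l).trace.re ≤ Φ
  upper : ((S.u : ℂ) • J - S.Γ).PosDef
  upper_le : (J * resolventU J S.Γ S.u).trace.re ≤ Ψ

variable {J : Matrix κ κ ℂ} {Φ Ψ δ ζ : ℝ} {S : AlgState m κ}

lemma shift_lower (G : Matrix (Fin m) (Fin m) ℂ) (l δ : ℝ) :
    G - (l : ℂ) • (1 : Matrix (Fin m) (Fin m) ℂ) =
      (G - ((l + δ : ℝ) : ℂ) • (1 : Matrix (Fin m) (Fin m) ℂ)) + (δ : ℂ) • 1 := by
  push_cast; module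

omit [Fintype κ] [DecidableEq κ] in
lemma shift_upper (J Γ : Matrix κ κ ℂ) (u ζ : ℝ) :
    ((u + ζ : ℝ) : ℂ) • J - Γ = ((u : ℂ) • J - Γ) + (ζ : ℂ) • J := by
  push_cast; module

lemma AlgState.Feasible.lower_shift (hS : S.Feasible J Φ Ψ) (hδ : 0 < δ) (hδΦ : δ * Φ < 1) :
    (S.G - ((S.l + δ : ℝ) : ℂ) • (1 : Matrix (Fin m) (Fin m) ℂ)).PosDef := by
  have h := hS.lower.sub_smul_one hδ
    ((mul_le_mul_of_nonneg_left hS.lower_le hδ.le).trans_lt hδΦ)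
  rwa [shift_lower S.G S.l δ, add_sub_cancel_right] at h

/-- The scalar in `matV` is a complex trace; the resolvents are Hermitian, so it is real and
`quadForm_smul` becomes applicable. -/
lemma matV_eq (hS : S.Feasible J Φ Ψ) (hδ : 0 < δ) (hδΦ : δ * Φ < 1) :
    matV δ S = ((((resolventL S.G (S.l + δ) - resolventL S.G S.l).trace.re)⁻¹ : ℝ) : ℂ) •
      resolventL S.G (S.l + δ) ^ 2 - resolventL S.G (S.l + δ) := by
  have hH : (resolventL S.G (S.l + δ) - resolventL S.G S.l).IsHermitian :=
    (hS.lower_shift hδ hδΦ).inv.1.sub hS.lower.inv.1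
  rw [matV, hH.trace_eq_ofReal_re]
  push_cast
  simp

/-- A product such as J U need not be Hermitian, so here the trace is known to be real because it is
positive. -/
lemma matW_eq [Nonempty κ] (hJ : J.PosDef) (hS : S.Feasible J Φ Ψ) (hζ : 0 < ζ) :
    matW J ζ S = ((((J * resolventU J S.Γ S.u - J * resolventU J S.Γ (S.u + ζ)).trace.re)⁻¹ : ℝ) : ℂ)
      • (resolventU J S.Γ (S.u + ζ) * J * resolventU J S.Γ (S.u + ζ))
        + resolventU J S.Γ (S.u + ζ) := by
  have h := (trace_upper_barrier hS.upper hJ hζ (shift_upper J S.Γ S.u ζ)).2.1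
  have e : (J * resolventU J S.Γ S.u - J * resolventU J S.Γ (S.u + ζ)).trace =
      ((J * resolventU J S.Γ S.u - J * resolventU J S.Γ (S.u + ζ)).trace.re : ℂ) :=
    Complex.eq_re_of_ofReal_le h.le
  rw [matW, e]
  push_cast
  simp

/-- An accepted step preserves the invariant. -/
lemma AlgState.Feasible.update [NeZero m] [Nonempty κ] (hJ : J.PosDef) (hS : S.Feasible J Φ Ψ)
    (hδ : 0 < δ) (hδΦ : δ * Φ < 1) (hζ : 0 < ζ) {ax : Fin m → ℂ} {bx : κ → ℂ} {w : ℝ}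
    (h : Accepts J δ ζ S ax bx w) : (updateState δ ζ S ax bx w).Feasible J Φ Ψ := by
  obtain ⟨hw, hW, hV⟩ := h
  have hA := hS.lower_shift hδ hδΦ
  have hl := trace_lower_barrier hA hS.lower hδ (shift_lower S.G S.l δ)
    ((mul_le_mul_of_nonneg_left hS.lower_le hδ.le).trans hδΦ.le)
  obtain ⟨hB, hT, -⟩ := trace_upper_barrier hS.upper hJ hζ (shift_upper J S.Γ S.u ζ)
  rw [matV_eq hS hδ hδΦ, quadForm_sub, quadForm_smul] at hV
  rw [matW_eq hJ hS hζ, quadForm_add, quadForm_smul] at hW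
  have e1 : (updateState δ ζ S ax bx w).G - ((updateState δ ζ S ax bx w).l : ℂ) • 1 =
      (S.G - ((S.l + δ : ℝ) : ℂ) • (1 : Matrix (Fin m) (Fin m) ℂ)) + (w : ℂ) • outer ax := by
    simp only [updateState]; abel
  have e2 : ((updateState δ ζ S ax bx w).u : ℂ) • J - (updateState δ ζ S ax bx w).Γ =
      (((S.u + ζ : ℝ) : ℂ) • J - S.Γ) - (w : ℂ) • outer bx := by
    simp only [updateState]; abel
  obtain ⟨h1, h2⟩ := posDef_sub_smul_outer_and_trace_le hB hJ hw (Complex.pos_iff.1 hT).1 hW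
  refine ⟨?_, ?_, ?_, ?_⟩
  · rw [e1]; exact hA.add_smul_outer hw.le _
  · rw [resolventL, e1]
    exact (trace_inv_add_smul_outer_le hA hw hl.1 hV).trans hS.lower_le
  · rw [e2]; exact h1
  · rw [resolventU, e2]; exact h2.trans hS.upper_le

/-- In a feasible state some point passes the test. -/
lemma AlgState.Feasible.exists_accepts [NeZero m] [Nonempty κ] {D : Type*} [MeasurableSpace D]
    {μ : Measure D} {a : D → Fin m → ℂ} {b : D → κ → ℂ}
    (ha : ∀ i, MemLp (fun x => a x i) 2 μ) (haI : gramJ μ a = 1)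
    (hb : ∀ i, MemLp (fun x => b x i) 2 μ) (hb0 : ∀ x, b x ≠ 0) (hbJ : gramJ μ b = J)
    (hJ : J.PosDef) (hS : S.Feasible J Φ Ψ)
    (hδ : 0 < δ) (hδΦ : δ * Φ < 1) (hζ : 0 < ζ) (hlt : ζ⁻¹ + Ψ < δ⁻¹ - Φ) :
    ∃ x w, Accepts J δ ζ S (a x) (b x) w := by
  have hl := trace_lower_barrier (hS.lower_shift hδ hδΦ) hS.lower hδ (shift_lower S.G S.l δ)
    ((mul_le_mul_of_nonneg_left hS.lower_le hδ.le).trans hδΦ.le)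
  obtain ⟨hB, hT, hu⟩ := trace_upper_barrier hS.upper hJ hζ (shift_upper J S.Γ S.u ζ)
  have hT' := (Complex.pos_iff.1 hT).1
  have h1 : δ⁻¹ - Φ ≤ ∫ x, quadForm (matV δ S) (a x) ∂μ := by
    rw [integral_quadForm ha, haI, mul_one, matV_eq hS hδ hδΦ, trace_sub, Complex.sub_re,
      trace_smul, smul_eq_mul, Complex.re_ofReal_mul]
    exact (sub_le_sub_left hS.lower_le _).trans hl.2
  have h2 : ∫ x, quadForm (matW J ζ S) (b x) ∂μ ≤ ζ⁻¹ + Ψ := by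
    rw [integral_quadForm hb, hbJ, matW_eq hJ hS hζ, trace_mul_comm, mul_add, trace_add,
      mul_smul_comm, trace_smul, Complex.add_re, smul_eq_mul, Complex.re_ofReal_mul]
    exact hu.trans (add_le_add le_rfl hS.upper_le)
  -- If the test failed strictly everywhere, integration would reverse the strict order of the two
  -- averages.
  have h3 : ∃ x, quadForm (matW J ζ S) (b x) < quadForm (matV δ S) (a x) := by
    by_contra! hcon
    have := integral_mono (integrable_quadForm ha (matV δ S)) (integrable_quadForm hb (matW J ζ S))
      hcon
    linarith
  obtain ⟨x, hx⟩ := h3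
  -- Since b(x) ≠ 0, the value of W is positive, hence so is the larger value of V, whose reciprocal
  -- serves as the weight.
  have h4 : 0 < quadForm (matW J ζ S) (b x) := by
    rw [matW_eq hJ hS hζ, quadForm_add, quadForm_smul]
    have h5 : 0 < quadForm (resolventU J S.Γ (S.u + ζ)) (b x) := hB.inv.quadForm_pos (hb0 x)
    have h6 : (resolventU J S.Γ (S.u + ζ) * J * resolventU J S.Γ (S.u + ζ)).PosSemidef := by
      have := hJ.posSemidef.mul_mul_conjTranspose_same (resolventU J S.Γ (S.u + ζ))
      rwa [show (resolventU J S.Γ (S.u + ζ))ᴴ = resolventU J S.Γ (S.u + ζ) from hB.inv.1.eq] at this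
    have h7 := h6.quadForm_nonneg (b x)
    have h8 : 0 ≤ ((J * resolventU J S.Γ S.u - J * resolventU J S.Γ (S.u + ζ)).trace.re)⁻¹ :=
      inv_nonneg.2 hT'.le
    have h9 := mul_nonneg h8 h7
    linarith
  refine ⟨x, (quadForm (matV δ S) (a x))⁻¹, inv_pos.2 (h4.trans hx), ?_, ?_⟩
  · rw [inv_inv]; exact hx.le
  · rw [inv_inv]

end Invariant

/-! ### Running the construction -/

section Output

variable {D : Type*} [MeasurableSpace D] {μ : Measure D} {m : ℕ} {κ : Type*} [Fintype κ]
  [DecidableEq κ]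

lemma rParam_pos (hm : 0 < m) (n : ℕ) : 0 < rParam m n :=
  Real.sqrt_pos.2 (by positivity)

lemma rParam_lt_one {n : ℕ} (hmn : m ≤ n) : rParam m n < 1 := by
  rw [rParam, Real.sqrt_lt' one_pos, one_pow, div_lt_one (by positivity)]
  have : (m : ℝ) ≤ n := by exact_mod_cast hmn
  linarith

lemma rParam_sq (m n : ℕ) : rParam m n ^ 2 * (n + 1) = m := by
  rw [rParam, Real.sq_sqrt (by positivity)]
  field_simp

lemma deltaStar_pos {n : ℕ} (hmn : m ≤ n) : 0 < deltaStar m n :=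
  div_pos (sub_pos.2 (rParam_lt_one hmn)) (by positivity)

omit [Fintype κ] in
lemma posDef_smul_one {c : ℝ} (hc : 0 < c) : ((c : ℂ) • (1 : Matrix κ κ ℂ)).PosDef :=
  PosDef.one.smul (by exact_mod_cast hc)

lemma inv_smul_one {c : ℝ} (hc : c ≠ 0) :
    ((c : ℂ) • (1 : Matrix κ κ ℂ))⁻¹ = ((c⁻¹ : ℝ) : ℂ) • 1 := by
  refine inv_eq_right_inv ?_
  rw [smul_mul_smul_comm, one_mul, ← Complex.ofReal_mul, mul_inv_cancel₀ hc]
  simp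

/-- The initial state is feasible. -/
lemma feasible_initState {n : ℕ} (hm : 0 < m) (hmn : m ≤ n) {J : Matrix κ κ ℂ}
    (hσ : 0 < sigmaParam J) (hs : 0 < sParam n J) :
    (initState m n J).Feasible J (m / (rParam m n * (1 - rParam m n)))
      (J.trace.re / (sParam n J * (sigmaParam J + sParam n J))) := by
  have hr : 0 < rParam m n * (1 - rParam m n) :=
    mul_pos (rParam_pos hm n) (sub_pos.2 (rParam_lt_one hmn))
  have hs' : 0 < sParam n J * (sigmaParam J + sParam n J) := by positivity
  have e1 : (initState m n J).G - ((initState m n J).l : ℂ) • (1 : Matrix (Fin m) (Fin m) ℂ) =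
      ((rParam m n * (1 - rParam m n) : ℝ) : ℂ) • 1 := by
    simp [initState]
  have e2 : ((initState m n J).u : ℂ) • J - (initState m n J).Γ =
      ((sParam n J * (sigmaParam J + sParam n J) : ℝ) : ℂ) • 1 := by
    simp [initState]
  refine ⟨?_, ?_, ?_, ?_⟩
  · rw [e1]; exact posDef_smul_one hr
  · rw [resolventL, e1, inv_smul_one hr.ne', trace_smul, trace_one, smul_eq_mul, Complex.re_ofReal_mul]
    simp [div_eq_inv_mul]
  · rw [e2]; exact posDef_smul_one hs'
  · rw [resolventU, e2, inv_smul_one hs'.ne', mul_smul_comm, mul_one, trace_smul, smul_eq_mul,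
      Complex.re_ofReal_mul, div_eq_inv_mul]

/-- By m = r²(n + 1) the product equals r. This is what allows the lower barrier to move. -/
lemma deltaStar_mul_lt_one {n : ℕ} (hm : 0 < m) (hmn : m ≤ n) :
    deltaStar m n * (m / (rParam m n * (1 - rParam m n))) < 1 := by
  have hr := rParam_pos hm n
  have hr1 := rParam_lt_one hmn
  have h : deltaStar m n * (m / (rParam m n * (1 - rParam m n))) = rParam m n := by
    have : 1 - rParam m n ≠ 0 := (sub_pos.2 hr1).ne'
    rw [deltaStar, ← rParam_sq m n]
    field_simp
  rwa [h]

/-- The initial values and δ_*, ζ_* are tuned so that the left side is n and the right side n + 1.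
-/
lemma potential_lt {n : ℕ} (hm : 0 < m) (hmn : m ≤ n) {J : Matrix κ κ ℂ}
    (hσ : 0 < sigmaParam J) (hs : 0 < sParam n J) :
    (zetaStar n J)⁻¹ + J.trace.re / (sParam n J * (sigmaParam J + sParam n J)) <
      (deltaStar m n)⁻¹ - m / (rParam m n * (1 - rParam m n)) := by
  have hr := rParam_pos hm n
  have hr1 := rParam_lt_one hmn
  have hn : (0 : ℝ) < n := by exact_mod_cast hm.trans_le hmn
  have h1 : (deltaStar m n)⁻¹ - m / (rParam m n * (1 - rParam m n)) = n + 1 := by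
    have : 1 - rParam m n ≠ 0 := (sub_pos.2 hr1).ne'
    rw [deltaStar, ← rParam_sq m n]
    field_simp
  have h2 : J.trace.re = n * sParam n J ^ 2 := by
    have : 0 < J.trace.re / n := Real.sqrt_pos.1 hs
    rw [sParam, Real.sq_sqrt this.le]
    field_simp
  have h3 : (zetaStar n J)⁻¹ + J.trace.re / (sParam n J * (sigmaParam J + sParam n J)) = n := by
    rw [h2, zetaStar]
    field_simp
  rw [h1, h3]
  linarith

/-- The construction can always be carried out. -/
theorem exists_isOutput {n : ℕ} (hm : 0 < m) (hmn : m ≤ n) [Nonempty κ]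
    {a : D → Fin m → ℂ} {b : D → κ → ℂ}
    (ha : ∀ i, MemLp (fun x => a x i) 2 μ) (haI : gramJ μ a = 1)
    (hb : ∀ i, MemLp (fun x => b x i) 2 μ) (hb0 : ∀ x, b x ≠ 0) (hJ : (gramJ μ b).PosDef)
    (hσ : 0 < sigmaParam (gramJ μ b)) (hs : 0 < sParam n (gramJ μ b)) :
    ∃ (x : Fin n → D) (w : Fin n → ℝ),
      IsOutput μ a b n (deltaStar m n) (zetaStar n (gramJ μ b)) x w := by
  have : NeZero m := ⟨hm.ne'⟩
  have hn : (0 : ℝ) < n := by exact_mod_cast hm.trans_le hmn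
  set J := gramJ μ b with hJd
  set Φ : ℝ := m / (rParam m n * (1 - rParam m n))
  set Ψ : ℝ := J.trace.re / (sParam n J * (sigmaParam J + sParam n J))
  have hδ := deltaStar_pos hmn
  have hζ : 0 < zetaStar n J := by rw [zetaStar]; positivity
  have hstep : ∀ S : {S : AlgState m κ // S.Feasible J Φ Ψ}, ∃ xw : D × ℝ,
      Accepts J (deltaStar m n) (zetaStar n J) S.1 (a xw.1) (b xw.1) xw.2 := fun S => by
    obtain ⟨x, w, h⟩ := S.2.exists_accepts ha haI hb hb0 hJd.symm hJ hδ
      (deltaStar_mul_lt_one hm hmn) hζ (potential_lt hm hmn hσ hs)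
    exact ⟨(x, w), h⟩
  choose xw hxw using hstep
  -- Finding the next point requires feasibility, so the recursion runs through the subtype of
  -- feasible states.
  let T : ℕ → {S : AlgState m κ // S.Feasible J Φ Ψ} := fun k =>
    Nat.rec ⟨initState m n J, feasible_initState hm hmn hσ hs⟩ (fun _ S =>
      ⟨updateState (deltaStar m n) (zetaStar n J) S.1 (a (xw S).1) (b (xw S).1) (xw S).2,
        S.2.update hJ hδ (deltaStar_mul_lt_one hm hmn) hζ (hxw S)⟩) k
  exact ⟨fun i => (xw (T i)).1, fun i => (xw (T i)).2, ⟨hδ, le_rfl, le_rfl⟩,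
    fun i => (T i).1, rfl, fun i => ⟨hxw (T i), rfl⟩⟩

lemma sum_succ_sub_castSucc {A : Type*} [AddCommGroup A] {n : ℕ} (f : Fin (n + 1) → A) :
    ∑ i : Fin n, (f i.succ - f i.castSucc) = f (Fin.last n) - f 0 := by
  induction n with
  | zero => simp
  | succ n ih =>
    rw [Fin.sum_univ_castSucc]
    have := ih fun i => f i.castSucc
    simp only [Fin.castSucc_zero, ← Fin.succ_castSucc] at this ⊢
    rw [this, Fin.succ_last]
    abel

/-- The spectral bounds for the output of the construction. -/
theorem IsOutput.posDef {n : ℕ} (hm : 0 < m) (hmn : m ≤ n) [Nonempty κ]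
    {a : D → Fin m → ℂ} {b : D → κ → ℂ} (hJ : (gramJ μ b).PosDef)
    (hσ : 0 < sigmaParam (gramJ μ b)) (hs : 0 < sParam n (gramJ μ b))
    {x : Fin n → D} {w : Fin n → ℝ}
    (h : IsOutput μ a b n (deltaStar m n) (zetaStar n (gramJ μ b)) x w) :
    (∀ i, 0 < w i) ∧
    ((∑ i, (w i : ℂ) • outer (a (x i))) -
      ((n * deltaStar m n - rParam m n * (1 - rParam m n) : ℝ) : ℂ) • 1).PosDef ∧
    (((n * zetaStar n (gramJ μ b) : ℝ) : ℂ) • gramJ μ b +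
      ((sParam n (gramJ μ b) * (sigmaParam (gramJ μ b) + sParam n (gramJ μ b)) : ℝ) : ℂ) • 1 -
        ∑ i, (w i : ℂ) • outer (b (x i))).PosDef := by
  have : NeZero m := ⟨hm.ne'⟩
  have hn : (0 : ℝ) < n := by exact_mod_cast hm.trans_le hmn
  obtain ⟨-, S, hS0, hS⟩ := h
  set J := gramJ μ b with hJd
  have hδ := deltaStar_pos hmn
  have hζ : 0 < zetaStar n J := by rw [zetaStar]; positivity
  have hF : ∀ i, (S i).Feasible J (m / (rParam m n * (1 - rParam m n)))
      (J.trace.re / (sParam n J * (sigmaParam J + sParam n J))) := by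
    intro i
    induction i using Fin.induction with
    | zero => rw [hS0]; exact feasible_initState hm hmn hσ hs
    | succ i ih =>
      rw [(hS i).2]
      exact ih.update hJ hδ (deltaStar_mul_lt_one hm hmn) hζ (hS i).1
  have hG : (S (Fin.last n)).G = (S 0).G + ∑ i, (w i : ℂ) • outer (a (x i)) := by
    have h1 := sum_succ_sub_castSucc fun i => (S i).G
    rw [← sub_eq_iff_eq_add', ← h1]
    exact Finset.sum_congr rfl fun i _ => by rw [(hS i).2]; simp [updateState]
  have hΓ : (S (Fin.last n)).Γ = (S 0).Γ + ∑ i, (w i : ℂ) • outer (b (x i)) := by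
    have h1 := sum_succ_sub_castSucc fun i => (S i).Γ
    rw [← sub_eq_iff_eq_add', ← h1]
    exact Finset.sum_congr rfl fun i _ => by rw [(hS i).2]; simp [updateState]
  have hl : (S (Fin.last n)).l = n * deltaStar m n := by
    have h1 := sum_succ_sub_castSucc fun i => (S i).l
    have h2 : (S 0).l = 0 := by rw [hS0]; rfl
    rw [h2, sub_zero] at h1
    rw [← h1, Finset.sum_congr rfl (g := fun _ => deltaStar m n) fun i _ => by
      rw [(hS i).2]; simp [updateState]]
    simp
  have hu : (S (Fin.last n)).u = n * zetaStar n J := by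
    have h1 := sum_succ_sub_castSucc fun i => (S i).u
    have h2 : (S 0).u = 0 := by rw [hS0]; rfl
    rw [h2, sub_zero] at h1
    rw [← h1, Finset.sum_congr rfl (g := fun _ => zetaStar n J) fun i _ => by
      rw [(hS i).2]; simp [updateState]]
    simp
  refine ⟨fun i => (hS i).1.1, ?_, ?_⟩
  · have h1 := (hF (Fin.last n)).lower
    rw [hG, hl, hS0] at h1
    convert h1 using 1
    simp only [initState]
    push_cast
    module
  · have h1 := (hF (Fin.last n)).upper
    rw [hΓ, hu, hS0] at h1
    convert h1 using 1
    simp only [initState]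
    push_cast
    module

end Output

end WLS

namespace WLS

/-! ### The spaces V_m and Fourier coefficients -/

section ApproxSpace

variable {D : Type*} {b : ℕ → D → ℂ} {m : ℕ} {g : D → ℂ}

lemma mem_approxSpace_iff :
    g ∈ approxSpace b m ↔ ∃ c : ℕ → ℂ, g = fun x => ∑ k ∈ Finset.range m, c k * b k x := by
  constructor
  · intro h
    induction h using Submodule.span_induction with
    | mem g hg =>
      obtain ⟨k, hk, rfl⟩ := hg
      refine ⟨Pi.single k 1, ?_⟩
      ext x
      have hk' : k < m := hk
      simp [Pi.single_apply, hk']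
    | zero => exact ⟨0, by ext; simp⟩
    | add g h _ _ hg hh =>
      obtain ⟨c, rfl⟩ := hg
      obtain ⟨d, rfl⟩ := hh
      exact ⟨c + d, by ext; simp [add_mul, Finset.sum_add_distrib]⟩
    | smul z g _ hg =>
      obtain ⟨c, rfl⟩ := hg
      exact ⟨z • c, by ext; simp [Finset.mul_sum, mul_assoc]⟩
  · rintro ⟨c, rfl⟩
    have : (fun x => ∑ k ∈ Finset.range m, c k * b k x) = ∑ k ∈ Finset.range m, c k • b k := by
      ext x; simp
    rw [this]
    exact Submodule.sum_mem _ fun k hk => Submodule.smul_mem _ _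
      (Submodule.subset_span ⟨k, by simpa using hk, rfl⟩)

lemma sum_mem_approxSpace {s : Finset ℕ} (hs : ∀ k ∈ s, k < m) (c : ℕ → ℂ) :
    (fun x => ∑ k ∈ s, c k * b k x) ∈ approxSpace b m := by
  have : (fun x => ∑ k ∈ s, c k * b k x) = ∑ k ∈ s, c k • b k := by
    ext x; simp
  rw [this]
  exact Submodule.sum_mem _ fun k hk => Submodule.smul_mem _ _
    (Submodule.subset_span ⟨k, hs k hk, rfl⟩)

end ApproxSpace

/-- The Fourier coefficient `⟨f, b_k⟩₂`. -/
noncomputable def fourierCoef {D : Type*} [MeasurableSpace D] (μ : Measure D) (b : ℕ → D → ℂ) (f : D → ℂ)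
    (k : ℕ) : ℂ := ∫ y, f y * star (b k y) ∂μ

/-- The `m`-th partial sum of the Fourier series. -/
noncomputable def partialSum {D : Type*} [MeasurableSpace D] (μ : Measure D) (b : ℕ → D → ℂ) (f : D → ℂ)
    (m : ℕ) : D → ℂ := fun x => ∑ k ∈ Finset.range m, fourierCoef μ b f k * b k x

/-! ### Orthonormal systems in L₂ -/

namespace IsOrthonormalSystem

variable {D : Type*} [MeasurableSpace D] {μ : Measure D} {b : ℕ → D → ℂ}
  (hb : IsOrthonormalSystem μ b)
include hb

/-- The class of `b_k` in `L₂`. -/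
noncomputable def lp (k : ℕ) : Lp ℂ 2 μ := (hb.1 k).toLp

lemma inner_lp_toLp {f : D → ℂ} (hf : MemLp f 2 μ) (k : ℕ) :
    inner ℂ (hb.lp k) hf.toLp = fourierCoef μ b f k := by
  rw [L2.inner_def, fourierCoef]
  refine integral_congr_ae ?_
  filter_upwards [(hb.1 k).coeFn_toLp, hf.coeFn_toLp] with x h1 h2
  rw [lp, h1, h2]
  simp [RCLike.inner_apply]

lemma orthonormal : Orthonormal ℂ hb.lp := by
  rw [orthonormal_iff_ite]
  intro i j
  have := hb.inner_lp_toLp (hb.1 j) i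
  rw [lp, lp]
  rw [lp] at this
  rw [this, fourierCoef, hb.2 j i]
  simp [eq_comm]

lemma coeFn_sum_lp (s : Finset ℕ) (c : ℕ → ℂ) :
    ⇑(∑ k ∈ s, c k • hb.lp k) =ᵐ[μ] fun x => ∑ k ∈ s, c k * b k x := by
  induction s using Finset.induction_on with
  | empty =>
    simp only [Finset.sum_empty]
    exact Lp.coeFn_zero ℂ 2 μ
  | insert a s ha ih =>
    rw [Finset.sum_insert ha]
    filter_upwards [ih, Lp.coeFn_add (c a • hb.lp a) (∑ k ∈ s, c k • hb.lp k),
      Lp.coeFn_smul (c a) (hb.lp a), (hb.1 a).coeFn_toLp] with x h1 h2 h3 h4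
    rw [h2, Pi.add_apply, h1, h3, Pi.smul_apply, Finset.sum_insert ha, lp, h4, smul_eq_mul]

lemma memLp_sum (s : Finset ℕ) (c : ℕ → ℂ) : MemLp (fun x => ∑ k ∈ s, c k * b k x) 2 μ :=
  (memLp_congr_ae (hb.coeFn_sum_lp s c)).1 (Lp.memLp _)

lemma memLp_of_mem {m : ℕ} {g : D → ℂ} (hg : g ∈ approxSpace b m) : MemLp g 2 μ := by
  obtain ⟨c, rfl⟩ := mem_approxSpace_iff.1 hg
  exact hb.memLp_sum _ _

lemma norm_sq_sum_lp (s : Finset ℕ) (c : ℕ → ℂ) :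
    ‖∑ k ∈ s, c k • hb.lp k‖ ^ 2 = ∑ k ∈ s, ‖c k‖ ^ 2 := by
  have h := hb.orthonormal.inner_sum c c s
  rw [inner_self_eq_norm_sq_to_K] at h
  have h2 : ∑ k ∈ s, (starRingEnd ℂ) (c k) * c k = ((∑ k ∈ s, ‖c k‖ ^ 2 : ℝ) : ℂ) := by
    push_cast
    exact Finset.sum_congr rfl fun k _ => Complex.conj_mul' _
  rw [h2] at h
  exact Complex.ofReal_injective (by rw [← h]; push_cast; rfl)

lemma eLpNorm_sum (s : Finset ℕ) (c : ℕ → ℂ) :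
    eLpNorm (fun x => ∑ k ∈ s, c k * b k x) 2 μ = ENNReal.ofReal (√(∑ k ∈ s, ‖c k‖ ^ 2)) := by
  rw [← eLpNorm_congr_ae (hb.coeFn_sum_lp s c), ← hb.norm_sq_sum_lp, Real.sqrt_sq (norm_nonneg _),
    ofReal_norm, Lp.enorm_def]

omit hb in
lemma eLpNorm_sub_toLp {f g : D → ℂ} (hf : MemLp f 2 μ) {G : Lp ℂ 2 μ} (hG : ⇑G =ᵐ[μ] g) :
    eLpNorm (f - g) 2 μ = ENNReal.ofReal ‖hf.toLp - G‖ := by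
  rw [ofReal_norm, Lp.enorm_def]
  refine eLpNorm_congr_ae ?_
  filter_upwards [Lp.coeFn_sub hf.toLp G, hf.coeFn_toLp, hG] with x h1 h2 h3
  rw [h1, Pi.sub_apply, Pi.sub_apply, h2, h3]

lemma inner_lp_sub_sum {f : D → ℂ} (hf : MemLp f 2 μ) (s : Finset ℕ) (c : ℕ → ℂ) (j : ℕ) :
    inner ℂ (hb.lp j) (hf.toLp - ∑ k ∈ s, c k • hb.lp k) =
      fourierCoef μ b f j - if j ∈ s then c j else 0 := by
  rw [inner_sub_right, hb.inner_lp_toLp hf]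
  congr 1
  split_ifs with h
  · exact hb.orthonormal.inner_right_sum c h
  · rw [inner_sum, Finset.sum_eq_zero]
    intro i hi
    rw [inner_smul_right, hb.orthonormal.inner_eq_zero (by rintro rfl; exact h hi), mul_zero]

/-- **Bessel's inequality** for the tail of the Fourier series. -/
lemma sum_sq_fourierCoef_le {f : D → ℂ} (hf : MemLp f 2 μ) {k : ℕ} {s : Finset ℕ}
    (hs : ∀ j ∈ s, k ≤ j) {E : ℝ} (hE : 0 ≤ E)
    (h : bestL2 μ f (approxSpace b k) ≤ ENNReal.ofReal E) :
    ∑ j ∈ s, ‖fourierCoef μ b f j‖ ^ 2 ≤ E ^ 2 := by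
  have h1 : ENNReal.ofReal (√(∑ j ∈ s, ‖fourierCoef μ b f j‖ ^ 2)) ≤
      bestL2 μ f (approxSpace b k) := by
    refine le_iInf₂ fun g hg => ?_
    obtain ⟨c, rfl⟩ := mem_approxSpace_iff.1 hg
    rw [eLpNorm_sub_toLp hf (hb.coeFn_sum_lp _ c)]
    refine ENNReal.ofReal_le_ofReal ((Real.sqrt_le_left (norm_nonneg _)).2 ?_)
    -- Subtracting an element of V_k leaves the coefficients with index j ≥ k unchanged, so Bessel
    -- for f - g bounds the tail of f.
    refine le_trans (le_of_eq ?_) (hb.orthonormal.sum_inner_products_le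
      (hf.toLp - ∑ k ∈ Finset.range k, c k • hb.lp k) (s := s))
    refine Finset.sum_congr rfl fun j hj => ?_
    rw [hb.inner_lp_sub_sum hf, if_neg (by simpa using hs j hj), sub_zero]
  have h2 := (ENNReal.ofReal_le_ofReal_iff hE).1 (h1.trans h)
  exact (Real.sqrt_le_left hE).1 h2

/-- The partial sums of the Fourier series are best approximations. -/
lemma eLpNorm_sub_partialSum_le {f : D → ℂ} (hf : MemLp f 2 μ) (m : ℕ) :
    eLpNorm (f - partialSum μ b f m) 2 μ ≤ bestL2 μ f (approxSpace b m) := by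
  refine le_iInf₂ fun g hg => ?_
  obtain ⟨c, rfl⟩ := mem_approxSpace_iff.1 hg
  have hP : _ =ᵐ[μ] partialSum μ b f m := hb.coeFn_sum_lp (Finset.range m) (fourierCoef μ b f)
  rw [eLpNorm_sub_toLp hf hP, eLpNorm_sub_toLp hf (hb.coeFn_sum_lp _ c)]
  refine ENNReal.ofReal_le_ofReal ?_
  set P := ∑ k ∈ Finset.range m, fourierCoef μ b f k • hb.lp k with hPd
  set G := ∑ k ∈ Finset.range m, c k • hb.lp k with hGd
  have hort : inner ℂ (P - G) (hf.toLp - P) = 0 := by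
    rw [hPd, hGd, ← Finset.sum_sub_distrib, sum_inner]
    refine Finset.sum_eq_zero fun k hk => ?_
    rw [← sub_smul, inner_smul_left, hb.inner_lp_sub_sum hf, if_pos hk, sub_self, mul_zero]
  have h1 := norm_add_sq (𝕜 := ℂ) (P - G) (hf.toLp - P)
  rw [hort, add_comm, sub_add_sub_cancel] at h1
  simp only [map_zero, mul_zero, add_zero] at h1
  refine (sq_le_sq₀ (norm_nonneg _) (norm_nonneg _)).1 ?_
  rw [h1]
  nlinarith [sq_nonneg ‖P - G‖]

/-- The norm inequality between `B(D)` and `L₂` on `V_m`. -/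
lemma norm_sum_le {m : ℕ} {L : ℝ}
    (hL : christoffelSup μ (approxSpace b m) ≤ ENNReal.ofReal L) {s : Finset ℕ}
    (hs : ∀ k ∈ s, k < m) (c : ℕ → ℂ) (hL0 : 0 ≤ L) (x : D) :
    ‖∑ k ∈ s, c k * b k x‖ ≤ L * √(∑ k ∈ s, ‖c k‖ ^ 2) := by
  set g : D → ℂ := fun x => ∑ k ∈ s, c k * b k x with hg
  have hgm : g ∈ approxSpace b m := sum_mem_approxSpace hs c
  rcases eq_or_ne g 0 with h0 | h0
  · have : ∑ k ∈ s, c k * b k x = 0 := congrFun h0 x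
    rw [this, norm_zero]
    positivity
  have h1 : supNorm g / eLpNorm g 2 μ ≤ ENNReal.ofReal L :=
    by
    refine le_trans ?_ hL
    exact le_iSup₂_of_le g hgm
      (le_iSup (fun _ : g ≠ 0 => supNorm g / eLpNorm g 2 μ) h0)
  have h2 := (ENNReal.div_le_iff_le_mul (Or.inr ENNReal.ofReal_ne_top)
    (Or.inl (hb.memLp_sum s c).eLpNorm_ne_top)).1 h1
  have h3 : ‖g x‖ₑ ≤ supNorm g := le_iSup (fun x => ‖g x‖ₑ) x
  have h4 := h3.trans h2
  rw [hg, hb.eLpNorm_sum, ← ENNReal.ofReal_mul hL0, ← ofReal_norm] at h4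
  exact (ENNReal.ofReal_le_ofReal_iff (by positivity)).1 h4

end IsOrthonormalSystem

/-! ### Interpolation between L₂ and the supremum -/

section Interpolation

variable {D : Type*} [MeasurableSpace D] {μ : Measure D}

/-- Integrate the pointwise bound |f|^p ≤ M^{p-2}|f|². -/
lemma eLpNorm_le_interpolation {f : D → ℂ} {p : ℝ} (hp : 2 ≤ p) {M : ℝ≥0∞} (hMt : M ≠ ∞)
    (hM : ∀ x, ‖f x‖ₑ ≤ M) :
    eLpNorm f (ENNReal.ofReal p) μ ≤ M ^ (1 - 2 / p) * eLpNorm f 2 μ ^ (2 / p) := by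
  have hp0 : 0 < p := by linarith
  have h1 : ∫⁻ x, ‖f x‖ₑ ^ p ∂μ ≤ M ^ (p - 2) * ∫⁻ x, ‖f x‖ₑ ^ (2 : ℝ) ∂μ := by
    calc ∫⁻ x, ‖f x‖ₑ ^ p ∂μ ≤ ∫⁻ x, M ^ (p - 2) * ‖f x‖ₑ ^ (2 : ℝ) ∂μ := by
          refine lintegral_mono fun x => ?_
          have : ‖f x‖ₑ ^ p = ‖f x‖ₑ ^ (p - 2) * ‖f x‖ₑ ^ (2 : ℝ) := by
            rw [← ENNReal.rpow_add_of_nonneg _ _ (by linarith) (by norm_num)]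
            congr 1; ring
          rw [this]
          refine mul_le_mul_left ?_ _
          exact ENNReal.rpow_le_rpow (hM x) (by linarith)
      _ = _ := lintegral_const_mul' _ _ (ENNReal.rpow_ne_top_of_nonneg (by linarith) hMt)
  rw [eLpNorm_eq_lintegral_rpow_enorm_toReal (by simpa using hp0) ENNReal.ofReal_ne_top,
    ENNReal.toReal_ofReal hp0.le,
    eLpNorm_eq_lintegral_rpow_enorm_toReal two_ne_zero ENNReal.ofNat_ne_top, ENNReal.toReal_ofNat]
  calc (∫⁻ x, ‖f x‖ₑ ^ p ∂μ) ^ (1 / p)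
      ≤ (M ^ (p - 2) * ∫⁻ x, ‖f x‖ₑ ^ (2 : ℝ) ∂μ) ^ (1 / p) := by gcongr
    _ = _ := by
      rw [ENNReal.mul_rpow_of_nonneg _ _ (by positivity), ← ENNReal.rpow_mul, ← ENNReal.rpow_mul]
      congr 2 <;> field_simp

end Interpolation

end WLS

namespace WLS

/-! ### Dyadic estimates for sums and decay rates -/

section Sums

lemma sum_Ico_dyadic {A : Type*} [AddCommMonoid A] (f : ℕ → A) (K L : ℕ) :
    ∑ j ∈ Finset.Ico K (2 ^ L * K), f j =
      ∑ l ∈ Finset.range L, ∑ j ∈ Finset.Ico (2 ^ l * K) (2 ^ (l + 1) * K), f j := by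
  induction L with
  | zero => simp
  | succ L ih =>
    rw [Finset.sum_range_succ, ← ih, Finset.sum_Ico_consecutive]
    · exact Nat.le_mul_of_pos_left _ (by positivity)
    · exact Nat.mul_le_mul_right _ (Nat.pow_le_pow_right two_pos (Nat.le_succ _))

/-- The first factor is geometric with ratio 2^{-γ} < 1 and beats any power of 1 + l, here bounded
by an integer power. -/
lemma summable_dyadic {γ β : ℝ} (hγ : 0 < γ) :
    Summable fun l : ℕ => ((2 : ℝ) ^ l) ^ (-γ) * (1 + l : ℝ) ^ β := by
  obtain ⟨n, hn⟩ := exists_nat_ge β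
  obtain ⟨ρ, hρ⟩ : ∃ ρ : ℝ, ρ = 2 ^ (-γ) := ⟨_, rfl⟩
  have hρ0 : 0 < ρ := by rw [hρ]; positivity
  have hρ1 : ρ < 1 := by
    rw [hρ]; exact Real.rpow_lt_one_of_one_lt_of_neg (by norm_num) (by linarith)
  have h0 : Summable fun l : ℕ => (l : ℝ) ^ n * ρ ^ l :=
    summable_pow_mul_geometric_of_norm_lt_one n (by rwa [Real.norm_of_nonneg hρ0.le])
  have h1 : Summable fun l : ℕ => ((l + 1 : ℕ) : ℝ) ^ n * ρ ^ (l + 1) :=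
    (summable_nat_add_iff (f := fun l : ℕ => (l : ℝ) ^ n * ρ ^ l) 1).2 h0
  refine Summable.of_nonneg_of_le (fun l => by positivity) (fun l => ?_) (h1.mul_left ρ⁻¹)
  have e1 : ((2 : ℝ) ^ l) ^ (-γ) = ρ ^ l := by
    rw [hρ, ← Real.rpow_natCast, ← Real.rpow_natCast, ← Real.rpow_mul (by norm_num),
      ← Real.rpow_mul (by norm_num), mul_comm]
  have e2 : (1 + l : ℝ) ^ β ≤ ((l + 1 : ℕ) : ℝ) ^ n := by
    rw [← Real.rpow_natCast _ n, Nat.cast_succ, add_comm]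
    exact Real.rpow_le_rpow_of_exponent_le (by linarith [l.cast_nonneg (α := ℝ)]) hn
  have e3 : ρ⁻¹ * (((l + 1 : ℕ) : ℝ) ^ n * ρ ^ (l + 1)) = ρ ^ l * ((l + 1 : ℕ) : ℝ) ^ n := by
    rw [pow_succ, mul_comm (ρ ^ l) ρ, mul_left_comm, inv_mul_cancel_left₀ hρ0.ne', mul_comm]
  rw [e1, e3]
  exact mul_le_mul_of_nonneg_left e2 (by positivity)

lemma exists_sum_dyadic_le {γ : ℝ} (hγ : 0 < γ) (β : ℝ) :
    ∃ S : ℝ, 0 < S ∧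
      ∀ L : ℕ, ∑ l ∈ Finset.range L, ((2 : ℝ) ^ l) ^ (-γ) * (1 + l : ℝ) ^ β ≤ S := by
  have h0 : 0 ≤ ∑' l : ℕ, ((2 : ℝ) ^ l) ^ (-γ) * (1 + l : ℝ) ^ β :=
    tsum_nonneg fun l => by positivity
  refine ⟨∑' l : ℕ, ((2 : ℝ) ^ l) ^ (-γ) * (1 + l : ℝ) ^ β + 1, by linarith, fun L => ?_⟩
  have := (summable_dyadic (β := β) hγ).sum_le_tsum (Finset.range L) fun l _ => by positivity
  linarith

/-- The decay profile `k^{-α} log^β k`. -/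
noncomputable def decay (α β : ℝ) (k : ℕ) : ℝ := (k : ℝ) ^ (-α) * Real.log k ^ β

lemma decay_nonneg (α β : ℝ) (k : ℕ) : 0 ≤ decay α β k :=
  mul_nonneg (by positivity) (Real.rpow_nonneg (Real.log_natCast_nonneg k) _)

lemma rpow_mul_decay {m : ℕ} (hm : 0 < m) (s α β : ℝ) :
    (m : ℝ) ^ s * decay α β m = decay (α - s) β m := by
  have : (0 : ℝ) < m := by exact_mod_cast hm
  rw [decay, decay, ← mul_assoc, ← Real.rpow_add this]
  congr 2; ring

/-- For m ≥ 2 one has log 2 ≤ log m, hence log(2^l m) ≤ (1 + l) log m. -/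
lemma decay_dyadic_le {β : ℝ} (hβ : 0 ≤ β) (α : ℝ) {m : ℕ} (hm : 2 ≤ m) (l : ℕ) :
    decay α β (2 ^ l * m) ≤ ((2 : ℝ) ^ l) ^ (-α) * (1 + l : ℝ) ^ β * decay α β m := by
  have hm' : (2 : ℝ) ≤ m := by exact_mod_cast hm
  have hlog : Real.log 2 ≤ Real.log m := Real.log_le_log (by norm_num) hm'
  have hlog0 : 0 ≤ Real.log m := Real.log_natCast_nonneg m
  rw [decay, decay]
  push_cast
  rw [Real.mul_rpow (by positivity) (by positivity), Real.log_mul (by positivity) (by positivity),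
    Real.log_pow]
  have h1 : (l * Real.log 2 + Real.log m) ^ β ≤ (1 + l : ℝ) ^ β * Real.log m ^ β := by
    rw [← Real.mul_rpow (by positivity) hlog0]
    have : 0 ≤ l * Real.log 2 := mul_nonneg (by positivity) (Real.log_nonneg (by norm_num))
    refine Real.rpow_le_rpow (by positivity) ?_ hβ
    nlinarith [l.cast_nonneg (α := ℝ)]
  calc _ ≤ ((2 : ℝ) ^ l) ^ (-α) * (m : ℝ) ^ (-α) * ((1 + l : ℝ) ^ β * Real.log m ^ β) := by
        gcongr
    _ = _ := by ring

/-- On the l-th dyadic block the weight is at most (2^{l+1}m)^{2t}, and the tail hypothesis at the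
start of the block bounds the rest. The blocks then decay like 2^{-2(α-t)l} up to powers of 1 + l,
so the bound is uniform in N. It is applied to c j = |f_j|². -/
lemma exists_weighted_sum_le {t α β : ℝ} (ht : 0 ≤ t) (htα : t < α) (hβ : 0 ≤ β) (C : ℝ) :
    ∃ B : ℝ, 0 < B ∧ ∀ c : ℕ → ℝ, (∀ j, 0 ≤ c j) →
      (∀ k : ℕ, 2 ≤ k → ∀ s : Finset ℕ, (∀ j ∈ s, k ≤ j) → ∑ j ∈ s, c j ≤ (C * decay α β k) ^ 2) →
      ∀ m N : ℕ, 2 ≤ m →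
        ∑ j ∈ Finset.Ico m N, (j : ℝ) ^ (2 * t) * c j ≤ B * decay (α - t) β m ^ 2 := by
  obtain ⟨S, hS0, hS⟩ := exists_sum_dyadic_le (γ := 2 * (α - t)) (by linarith) (2 * β)
  -- The summand 1 only keeps the constant positive when C = 0.
  refine ⟨(C ^ 2 + 1) * 2 ^ (2 * t) * S, by positivity, fun c hc h m N hm => ?_⟩
  have hm0 : 0 < m := by omega
  have hblock : ∀ l : ℕ, ∑ j ∈ Finset.Ico (2 ^ l * m) (2 ^ (l + 1) * m), (j : ℝ) ^ (2 * t) * c j ≤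
      (C ^ 2 * 2 ^ (2 * t) * decay (α - t) β m ^ 2) *
        (((2 : ℝ) ^ l) ^ (-(2 * (α - t))) * (1 + l : ℝ) ^ (2 * β)) := by
    intro l
    have h2l : 2 ≤ 2 ^ l * m := hm.trans (Nat.le_mul_of_pos_left _ (by positivity))
    calc _ ≤ ∑ j ∈ Finset.Ico (2 ^ l * m) (2 ^ (l + 1) * m),
          ((2 : ℝ) ^ (l + 1) * m) ^ (2 * t) * c j := by
          refine Finset.sum_le_sum fun j hj => mul_le_mul_of_nonneg_right ?_ (hc j)
          refine Real.rpow_le_rpow (by positivity) ?_ (by linarith)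
          exact_mod_cast (Finset.mem_Ico.1 hj).2.le
      _ = ((2 : ℝ) ^ (l + 1) * m) ^ (2 * t) * ∑ j ∈ Finset.Ico (2 ^ l * m) (2 ^ (l + 1) * m), c j := by
          rw [Finset.mul_sum]
      _ ≤ ((2 : ℝ) ^ (l + 1) * m) ^ (2 * t) * (C * decay α β (2 ^ l * m)) ^ 2 := by
          gcongr
          exact h _ h2l _ fun j hj => (Finset.mem_Ico.1 hj).1
      _ ≤ ((2 : ℝ) ^ (l + 1) * m) ^ (2 * t) *
            (C ^ 2 * (((2 : ℝ) ^ l) ^ (-α) * (1 + l : ℝ) ^ β * decay α β m) ^ 2) := by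
          rw [mul_pow]
          gcongr
          · exact decay_nonneg _ _ _
          · exact decay_dyadic_le hβ α hm l
      _ = _ := by
          have e1 : ((2 : ℝ) ^ (l + 1) * m) ^ (2 * t) =
              2 ^ (2 * t) * (((2 : ℝ) ^ l) ^ t) ^ 2 * ((m : ℝ) ^ t) ^ 2 := by
            rw [pow_succ, Real.mul_rpow (by positivity) (by positivity),
              Real.mul_rpow (by positivity) (by positivity), ← Real.rpow_natCast (_ ^ t),
              ← Real.rpow_natCast (_ ^ t), ← Real.rpow_mul (by positivity),
              ← Real.rpow_mul (by positivity), mul_comm t]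
            push_cast
            ring
          have e2 : ((2 : ℝ) ^ l) ^ (-(2 * (α - t))) = (((2 : ℝ) ^ l) ^ t * ((2 : ℝ) ^ l) ^ (-α)) ^ 2 := by
            rw [← Real.rpow_add (by positivity), ← Real.rpow_natCast (_ ^ (t + -α)),
              ← Real.rpow_mul (by positivity)]
            congr 1; push_cast; ring
          have e3 : (1 + l : ℝ) ^ (2 * β) = ((1 + l : ℝ) ^ β) ^ 2 := by
            rw [← Real.rpow_natCast, ← Real.rpow_mul (by positivity), mul_comm]
            norm_num
          rw [e1, e2, e3, ← rpow_mul_decay hm0]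
          ring
  calc _ ≤ ∑ j ∈ Finset.Ico m (2 ^ N * m), (j : ℝ) ^ (2 * t) * c j := by
        refine Finset.sum_le_sum_of_subset_of_nonneg (Finset.Ico_subset_Ico le_rfl ?_)
          fun j _ _ => mul_nonneg (by positivity) (hc j)
        exact Nat.lt_two_pow_self.le.trans (Nat.le_mul_of_pos_right _ hm0)
    _ ≤ ∑ l ∈ Finset.range N, (C ^ 2 * 2 ^ (2 * t) * decay (α - t) β m ^ 2) *
        (((2 : ℝ) ^ l) ^ (-(2 * (α - t))) * (1 + l : ℝ) ^ (2 * β)) := by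
        rw [sum_Ico_dyadic]
        exact Finset.sum_le_sum fun l _ => hblock l
    _ ≤ (C ^ 2 * 2 ^ (2 * t) * decay (α - t) β m ^ 2) * S := by
        rw [← Finset.mul_sum]
        gcongr
        exact hS N
    _ ≤ ((C ^ 2 + 1) * 2 ^ (2 * t) * decay (α - t) β m ^ 2) * S := by
        gcongr; linarith
    _ = _ := by ring

lemma exists_sum_rpow_le {t : ℝ} (ht : 1 / 2 < t) :
    ∃ B : ℝ, 0 < B ∧ ∀ m N : ℕ, 1 ≤ m →
      ∑ k ∈ Finset.Icc m N, (k : ℝ) ^ (-(2 * t)) ≤ B * (m : ℝ) ^ (1 - 2 * t) := by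
  obtain ⟨S, hS0, hS⟩ := exists_sum_dyadic_le (γ := 2 * t - 1) (by linarith) 0
  refine ⟨S, hS0, fun m N hm => ?_⟩
  have hm0 : (0 : ℝ) < m := by exact_mod_cast hm
  have hblock : ∀ l : ℕ, ∑ j ∈ Finset.Ico (2 ^ l * m) (2 ^ (l + 1) * m), (j : ℝ) ^ (-(2 * t)) ≤
      (m : ℝ) ^ (1 - 2 * t) * (((2 : ℝ) ^ l) ^ (-(2 * t - 1)) * (1 + l : ℝ) ^ (0 : ℝ)) := by
    intro l
    have hpos : (0 : ℝ) < 2 ^ l * m := by positivity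
    calc _ ≤ ∑ j ∈ Finset.Ico (2 ^ l * m) (2 ^ (l + 1) * m), ((2 : ℝ) ^ l * m) ^ (-(2 * t)) := by
          refine Finset.sum_le_sum fun j hj => Real.rpow_le_rpow_of_nonpos hpos ?_ (by linarith)
          exact_mod_cast (Finset.mem_Ico.1 hj).1
      _ = ((2 : ℝ) ^ l * m) * ((2 : ℝ) ^ l * m) ^ (-(2 * t)) := by
          have : 2 ^ (l + 1) * m - 2 ^ l * m = 2 ^ l * m := by
            rw [pow_succ, mul_comm (2 ^ l) 2, mul_assoc, two_mul, Nat.add_sub_cancel]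
          rw [Finset.sum_const, Nat.card_Ico, this, nsmul_eq_mul]
          push_cast
          rfl
      _ = ((2 : ℝ) ^ l * m) ^ (1 - 2 * t) := by
          rw [sub_eq_add_neg, Real.rpow_add hpos, Real.rpow_one]
      _ = _ := by
          rw [Real.mul_rpow (by positivity) hm0.le, Real.rpow_zero, neg_sub, mul_one, mul_comm]
  calc _ ≤ ∑ j ∈ Finset.Ico m (2 ^ (N + 1) * m), (j : ℝ) ^ (-(2 * t)) := by
        refine Finset.sum_le_sum_of_subset_of_nonneg (fun j hj => ?_) fun j _ _ => by positivity
        rw [Finset.mem_Icc] at hj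
        rw [Finset.mem_Ico]
        exact ⟨hj.1, ((Nat.lt_succ_of_le hj.2).trans Nat.lt_two_pow_self).trans_le
          (Nat.le_mul_of_pos_right _ hm)⟩
    _ ≤ _ := by
        rw [sum_Ico_dyadic]
        refine (Finset.sum_le_sum fun l _ => hblock l).trans ?_
        rw [← Finset.mul_sum, mul_comm]
        gcongr
        exact hS _

/-- For K near m^q/2, with q = α/(α - θ), the power of K is already of order m^{-α}. However, K may
be far larger, and then log K is not controlled by log m. The excess y = 2K/m^q contributes y^{-γ},
which absorbs the logarithm of y. -/
lemma exists_decay_le {θ α β : ℝ} (hθ : 0 < θ) (hθα : θ < α) (hβ : 0 ≤ β) :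
    ∃ B : ℝ, 0 < B ∧ ∀ m K : ℕ, 2 ≤ m → 2 ≤ K → (m : ℝ) ^ (α / (α - θ)) ≤ 2 * K →
      decay (α - θ) β K ≤ B * decay α β m := by
  set γ := α - θ with hγ
  have hγ0 : 0 < γ := by linarith
  set q := α / γ with hq
  have hq0 : 0 < q := by have : 0 < α := by linarith
                         positivity
  -- This gives εβ ≤ γ, so y^{εβ} is absorbed by y^{-γ}; the 1 avoids division by zero at β = 0.
  set ε := γ / (β + 1) with hε
  have hε0 : 0 < ε := by positivity
  refine ⟨2 ^ γ * (2 / ε + q) ^ β, by positivity, fun m K hm hK h => ?_⟩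
  have hm' : (2 : ℝ) ≤ m := by exact_mod_cast hm
  have hK' : (2 : ℝ) ≤ K := by exact_mod_cast hK
  have hm0 : (0 : ℝ) < m := by linarith
  have hmq : 0 < (m : ℝ) ^ q := by positivity
  have hlogm : 1 / 2 ≤ Real.log m :=
    le_trans (by linarith [Real.log_two_gt_d9]) (Real.log_le_log (by norm_num) hm')
  set y : ℝ := 2 * K / (m : ℝ) ^ q with hy
  have hy1 : 1 ≤ y := by rw [hy, le_div_iff₀ hmq]; linarith
  have hy0 : 0 < y := by linarith
  have hKy : (K : ℝ) = y * (m : ℝ) ^ q / 2 := by rw [hy]; field_simp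
  have hlog : Real.log K ≤ y ^ ε * ((2 / ε + q) * Real.log m) := by
    have h1 : Real.log K ≤ Real.log (y * (m : ℝ) ^ q) :=
      Real.log_le_log (by linarith) (by rw [hKy]; linarith [mul_pos hy0 hmq])
    rw [Real.log_mul hy0.ne' hmq.ne', Real.log_rpow hm0] at h1
    have h2 : Real.log y ≤ y ^ ε / ε := Real.log_le_rpow_div hy0.le hε0
    have h3 : 1 ≤ y ^ ε := Real.one_le_rpow hy1 hε0.le
    have h4 : y ^ ε / ε ≤ y ^ ε * (2 / ε * Real.log m) := by
      rw [div_eq_mul_inv]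
      gcongr
      rw [div_mul_eq_mul_div, le_div_iff₀ hε0, inv_mul_cancel₀ hε0.ne']
      linarith
    have h5 : q * Real.log m ≤ y ^ ε * (q * Real.log m) :=
      le_mul_of_one_le_left (by positivity) h3
    linarith
  have hpow : Real.log K ^ β ≤ y ^ (ε * β) * ((2 / ε + q) ^ β * Real.log m ^ β) := by
    calc Real.log K ^ β ≤ (y ^ ε * ((2 / ε + q) * Real.log m)) ^ β :=
          Real.rpow_le_rpow (Real.log_natCast_nonneg K) hlog hβ
      _ = _ := by
          rw [Real.mul_rpow (by positivity) (by positivity),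
            Real.mul_rpow (by positivity) (by positivity), ← Real.rpow_mul hy0.le]
  have hK2 : (K : ℝ) ^ (-γ) = 2 ^ γ * y ^ (-γ) * (m : ℝ) ^ (-α) := by
    rw [hKy, Real.div_rpow (by positivity) (by norm_num), Real.mul_rpow hy0.le hmq.le,
      ← Real.rpow_mul hm0.le, Real.rpow_neg (by norm_num : (0 : ℝ) ≤ 2)]
    have : q * -γ = -α := by rw [hq]; field_simp
    rw [this]
    field_simp
  have hyle : y ^ (-γ) * y ^ (ε * β) ≤ 1 := by
    rw [← Real.rpow_add hy0]
    refine Real.rpow_le_one_of_one_le_of_nonpos hy1 ?_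
    have : ε * β ≤ ε * (β + 1) := by gcongr; linarith
    have h2 : ε * (β + 1) = γ := by rw [hε]; field_simp
    linarith
  have hL : 0 ≤ Real.log m ^ β := by positivity
  rw [decay, decay, hK2]
  calc _ ≤ 2 ^ γ * y ^ (-γ) * (m : ℝ) ^ (-α) *
        (y ^ (ε * β) * ((2 / ε + q) ^ β * Real.log m ^ β)) := by gcongr
    _ = (y ^ (-γ) * y ^ (ε * β)) * (2 ^ γ * (2 / ε + q) ^ β * ((m : ℝ) ^ (-α) * Real.log m ^ β)) := by
        ring
    _ ≤ _ := mul_le_of_le_one_left (by positivity) hyle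

end Sums

/-! ### Uniform convergence rate of the Fourier series -/

section SupNorm

/-- A dyadic block lies in V_{2^{l+1}K}, so (1) bounds it by (2^{l+1}K)^θ times the ℓ₂ norm of its
coefficients. The block bounds are summable because θ < α, and pointwise convergence along the
indices 2^L K transfers the estimate to f. -/
lemma exists_norm_sub_partialSum_le {θ α β : ℝ} (hθα : θ < α) (hβ : 0 ≤ β)
    (C₁ C₂ : ℝ) :
    ∃ B : ℝ, 0 < B ∧ ∀ {D : Type*} [MeasurableSpace D] {μ : Measure D} {b : ℕ → D → ℂ},
      IsOrthonormalSystem μ b →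
      (∀ m : ℕ, 2 ≤ m → christoffelSup μ (approxSpace b m) ≤ ENNReal.ofReal (C₁ * (m : ℝ) ^ θ)) →
      ∀ f : D → ℂ, HasPointwiseFourierSeries μ b f →
      (∀ k : ℕ, 2 ≤ k → ∀ s : Finset ℕ, (∀ j ∈ s, k ≤ j) →
        ∑ j ∈ s, ‖fourierCoef μ b f j‖ ^ 2 ≤ (C₂ * decay α β k) ^ 2) →
      ∀ K : ℕ, 2 ≤ K → ∀ x, ‖f x - partialSum μ b f K x‖ ≤ B * decay (α - θ) β K := by
  obtain ⟨S, hS0, hS⟩ := exists_sum_dyadic_le (γ := α - θ) (by linarith) β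
  refine ⟨(|C₁| * |C₂| + 1) * 2 ^ θ * S, by positivity, ?_⟩
  intro D _ μ b hb hL f hf hc K hK x
  have hK0 : 0 < K := by omega
  have hblock : ∀ l : ℕ, ‖∑ j ∈ Finset.Ico (2 ^ l * K) (2 ^ (l + 1) * K),
      fourierCoef μ b f j * b j x‖ ≤ (|C₁| * |C₂| * 2 ^ θ * decay (α - θ) β K) *
        (((2 : ℝ) ^ l) ^ (-(α - θ)) * (1 + l : ℝ) ^ β) := by
    intro l
    have h2l : 2 ≤ 2 ^ l * K := hK.trans (Nat.le_mul_of_pos_left _ (by positivity))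
    have h2l' : 2 ≤ 2 ^ (l + 1) * K := hK.trans (Nat.le_mul_of_pos_left _ (by positivity))
    have hL' : christoffelSup μ (approxSpace b (2 ^ (l + 1) * K)) ≤
        ENNReal.ofReal (|C₁| * ((2 : ℝ) ^ (l + 1) * K) ^ θ) := by
      refine (hL _ h2l').trans (ENNReal.ofReal_le_ofReal ?_)
      push_cast
      gcongr
      exact le_abs_self _
    refine (hb.norm_sum_le hL' (fun k hk => (Finset.mem_Ico.1 hk).2) _ (by positivity) x).trans ?_
    have hs : √(∑ j ∈ Finset.Ico (2 ^ l * K) (2 ^ (l + 1) * K), ‖fourierCoef μ b f j‖ ^ 2) ≤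
        |C₂| * (((2 : ℝ) ^ l) ^ (-α) * (1 + l : ℝ) ^ β * decay α β K) := by
      calc _ ≤ √((C₂ * decay α β (2 ^ l * K)) ^ 2) :=
            Real.sqrt_le_sqrt (hc _ h2l _ fun j hj => (Finset.mem_Ico.1 hj).1)
        _ = |C₂| * decay α β (2 ^ l * K) := by
            rw [Real.sqrt_sq_eq_abs, abs_mul, abs_of_nonneg (decay_nonneg _ _ _)]
        _ ≤ _ := by
            gcongr
            exact decay_dyadic_le hβ α hK l
    refine (mul_le_mul_of_nonneg_left hs (by positivity)).trans (le_of_eq ?_)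
    have e1 : ((2 : ℝ) ^ (l + 1) * K) ^ θ = 2 ^ θ * ((2 : ℝ) ^ l) ^ θ * (K : ℝ) ^ θ := by
      rw [pow_succ, Real.mul_rpow (by positivity) (by positivity),
        Real.mul_rpow (by positivity) (by positivity)]
      ring
    have e2 : ((2 : ℝ) ^ l) ^ (-(α - θ)) = ((2 : ℝ) ^ l) ^ θ * ((2 : ℝ) ^ l) ^ (-α) := by
      rw [← Real.rpow_add (by positivity)]
      congr 1; ring
    rw [e1, e2, ← rpow_mul_decay hK0]
    ring
  have hpart : ∀ L : ℕ, ‖partialSum μ b f (2 ^ L * K) x - partialSum μ b f K x‖ ≤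
      (|C₁| * |C₂| + 1) * 2 ^ θ * S * decay (α - θ) β K := by
    intro L
    have e : partialSum μ b f (2 ^ L * K) x - partialSum μ b f K x =
        ∑ j ∈ Finset.Ico K (2 ^ L * K), fourierCoef μ b f j * b j x := by
      rw [partialSum, partialSum, Finset.sum_Ico_eq_sub _
        (Nat.le_mul_of_pos_left _ (by positivity))]
    have hd := decay_nonneg (α - θ) β K
    rw [e, sum_Ico_dyadic]
    calc _ ≤ ∑ l ∈ Finset.range L, (|C₁| * |C₂| * 2 ^ θ * decay (α - θ) β K) *
        (((2 : ℝ) ^ l) ^ (-(α - θ)) * (1 + l : ℝ) ^ β) :=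
          (norm_sum_le _ _).trans (Finset.sum_le_sum fun l _ => hblock l)
      _ ≤ (|C₁| * |C₂| * 2 ^ θ * decay (α - θ) β K) * S := by
          rw [← Finset.mul_sum]
          gcongr
          exact hS L
      _ ≤ ((|C₁| * |C₂| + 1) * 2 ^ θ * decay (α - θ) β K) * S := by
          gcongr
          linarith
      _ = _ := by ring
  have hlim : Tendsto (fun L : ℕ => 2 ^ L * K) atTop atTop :=
    tendsto_atTop_mono (fun L => Nat.lt_two_pow_self.le.trans (Nat.le_mul_of_pos_right _ hK0))
      tendsto_id
  exact le_of_tendsto (((hf x).comp hlim).sub_const _).norm (Eventually.of_forall hpart)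

end SupNorm

end WLS

namespace WLS

/-! ### Abstract least squares -/

section LeastSquares

variable {X H : Type*} [AddCommGroup X] [Module ℂ X] [NormedAddCommGroup H]
  [InnerProductSpace ℂ H] [FiniteDimensional ℂ H] (E : X →ₗ[ℂ] H) (V : Submodule ℂ X)

/-- Take g to be any preimage in V of the orthogonal projection of E f onto E(V). Injectivity of E
on V is needed only for uniqueness. -/
lemma exists_least_squares_pythagoras (f : X) :
    ∃ g ∈ V, ∀ h ∈ V, ‖E (f - h)‖ ^ 2 = ‖E (f - g)‖ ^ 2 + ‖E (g - h)‖ ^ 2 := by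
  have hP := (V.map E).starProjection_apply_mem (E f)
  obtain ⟨g, hg, hgP⟩ := hP
  refine ⟨g, hg, fun h hh => ?_⟩
  have hort : inner ℂ (E (f - g)) (E (g - h)) = 0 := by
    rw [map_sub, hgP]
    exact (V.map E).starProjection_inner_eq_zero (E f) _ ⟨g - h, V.sub_mem hg hh, rfl⟩
  have h1 := norm_add_sq (𝕜 := ℂ) (E (f - g)) (E (g - h))
  rw [hort, ← map_add, sub_add_sub_cancel] at h1
  simpa using h1

lemma existsUnique_least_squares (hE : ∀ g ∈ V, E g = 0 → g = 0) (f : X) :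
    ∃! g, g ∈ V ∧ ∀ h ∈ V, ‖E (f - g)‖ ^ 2 ≤ ‖E (f - h)‖ ^ 2 := by
  obtain ⟨g, hg, hgP⟩ := exists_least_squares_pythagoras E V f
  refine ⟨g, ⟨hg, fun h hh => ?_⟩, fun h ⟨hh, hmin⟩ => ?_⟩
  · rw [hgP h hh]; nlinarith [sq_nonneg ‖E (g - h)‖]
  · have h1 := hmin g hg
    rw [hgP h hh] at h1
    have h2 : ‖E (g - h)‖ ^ 2 = 0 := le_antisymm (by linarith) (sq_nonneg _)
    have h3 : E (g - h) = 0 := by simpa using h2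
    exact (sub_eq_zero.1 (hE _ (V.sub_mem hg hh) h3)).symm

/-- Every minimiser has the same image under E as the projected one, so E(g - p) is the projection
of E(f - p). Used with p the Fourier partial sum. -/
lemma least_squares_contraction {f g p : X} (hg : g ∈ V)
    (hmin : ∀ h ∈ V, ‖E (f - g)‖ ^ 2 ≤ ‖E (f - h)‖ ^ 2) (hp : p ∈ V) :
    ‖E (g - p)‖ ^ 2 ≤ ‖E (f - p)‖ ^ 2 := by
  obtain ⟨g₀, hg₀, hP⟩ := exists_least_squares_pythagoras E V f
  have h1 := hmin g₀ hg₀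
  rw [hP g hg] at h1
  have h2 : ‖E (g₀ - g)‖ ^ 2 = 0 := le_antisymm (by linarith) (sq_nonneg _)
  have h3 : E (g₀ - g) = 0 := by simpa using h2
  have h4 : E (g - p) = E (g₀ - p) := by
    rw [map_sub, map_sub, sub_eq_zero.1 ((map_sub E g₀ g).symm.trans h3)]
  rw [h4, hP p hp]
  nlinarith [sq_nonneg ‖E (f - g₀)‖]

/-- The weighted evaluation `h ↦ (√w_i h(x_i))_i`. -/
noncomputable def weightedEval {D : Type*} {n : ℕ} (x : Fin n → D) (w : Fin n → ℝ) :
    (D → ℂ) →ₗ[ℂ] EuclideanSpace ℂ (Fin n) where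
  toFun h := WithLp.toLp 2 fun i => ((√(w i) : ℝ) : ℂ) * h (x i)
  map_add' g h := by ext i; simp [mul_add]
  map_smul' z h := by ext i; simp [mul_left_comm]

lemma norm_weightedEval_sq {D : Type*} {n : ℕ} (x : Fin n → D) {w : Fin n → ℝ}
    (hw : ∀ i, 0 < w i) (h : D → ℂ) :
    ‖weightedEval x w h‖ ^ 2 = ∑ i, w i * ‖h (x i)‖ ^ 2 := by
  rw [EuclideanSpace.norm_sq_eq]
  refine Finset.sum_congr rfl fun i _ => ?_
  simp only [weightedEval, LinearMap.coe_mk, AddHom.coe_mk]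
  rw [norm_mul, mul_pow, Complex.norm_real, Real.norm_of_nonneg (Real.sqrt_nonneg _),
    Real.sq_sqrt (hw i).le]

lemma isLeastSquares_iff {D : Type*} {n : ℕ} {V : Submodule ℂ (D → ℂ)} {x : Fin n → D}
    {w : Fin n → ℝ} (hw : ∀ i, 0 < w i) {f g : D → ℂ} :
    IsLeastSquares V x w f g ↔ g ∈ V ∧
      ∀ h ∈ V, ‖weightedEval x w (f - g)‖ ^ 2 ≤ ‖weightedEval x w (f - h)‖ ^ 2 := by
  simp only [norm_weightedEval_sq x hw]
  rfl

end LeastSquares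

/-! ### The designs for weighted least squares -/

section Design

open Matrix
open scoped ComplexOrder

variable {D : Type*} [MeasurableSpace D] {μ : Measure D} {b : ℕ → D → ℂ} {t : ℝ} {m N : ℕ}

lemma rpow_neg_le_cParam (t : ℝ) (m N : ℕ) : (m : ℝ) ^ (-t) ≤ cParam t m N :=
  le_add_of_nonneg_right (Real.sqrt_nonneg _)

lemma cParam_pos (t : ℝ) (hm : 1 ≤ m) (N : ℕ) : 0 < cParam t m N :=
  lt_of_lt_of_le (Real.rpow_pos_of_pos (by exact_mod_cast hm) _) (rpow_neg_le_cParam t m N)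

/-- The sum is of order m^{1-2t}; the factor 1/(2m) under the root brings this down to m^{-2t}. -/
lemma exists_cParam_le (ht : 1 / 2 < t) :
    ∃ B : ℝ, 0 < B ∧ ∀ m N : ℕ, 1 ≤ m → cParam t m N ≤ B * (m : ℝ) ^ (-t) := by
  obtain ⟨B, hB0, hB⟩ := exists_sum_rpow_le ht
  refine ⟨1 + √B, by positivity, fun m N hm => ?_⟩
  have hm0 : (0 : ℝ) < m := by exact_mod_cast hm
  have h1 : √(1 / (2 * (m : ℝ)) * ∑ k ∈ Finset.Icc m N, (k : ℝ) ^ (-(2 * t))) ≤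
      √B * (m : ℝ) ^ (-t) := by
    rw [Real.sqrt_le_left (by positivity), mul_pow, Real.sq_sqrt hB0.le, ← Real.rpow_natCast,
      ← Real.rpow_mul hm0.le]
    calc _ ≤ 1 / (2 * (m : ℝ)) * (B * (m : ℝ) ^ (1 - 2 * t)) := by
          gcongr
          exact hB m N hm
      _ = 1 / 2 * (B * (m : ℝ) ^ (-t * (2 : ℕ))) := by
          have : (1 : ℝ) - 2 * t = 1 + -t * (2 : ℕ) := by push_cast; ring
          rw [this, Real.rpow_add hm0, Real.rpow_one]
          field_simp
      _ ≤ _ := by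
          exact mul_le_of_le_one_left (by positivity) (by norm_num)
  rw [cParam]
  linarith

lemma memLp_inputA (hb : IsOrthonormalSystem μ b) (i : Fin m) :
    MemLp (fun x => inputA b m x i) 2 μ := hb.1 i

lemma gramJ_inputA (hb : IsOrthonormalSystem μ b) : gramJ μ (inputA b m) = 1 := by
  ext i j
  simp only [gramJ, of_apply, outer, vecMulVec_apply, inputA, Pi.star_apply, hb.2, one_apply,
    Fin.ext_iff]

/-- The diagonal of the matrix `J` for the input `b`. -/
noncomputable def inputDiag (t : ℝ) (m N : ℕ) : Option {k : ℕ // k ∈ Finset.Ico m N} → ℝ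
  | none => cParam t m N ^ 2
  | some k => ((k.1 : ℝ) ^ (-t)) ^ 2

lemma inputDiag_pos (t : ℝ) (hm : 1 ≤ m) (N : ℕ) (o) : 0 < inputDiag t m N o := by
  rcases o with _ | ⟨k, hk⟩
  · exact pow_pos (cParam_pos t hm N) 2
  · have : (0 : ℝ) < k := by exact_mod_cast hm.trans (Finset.mem_Ico.1 hk).1
    simp only [inputDiag]
    positivity

lemma inputDiag_le (ht : 0 ≤ t) (hm : 1 ≤ m) (N : ℕ) (o) :
    inputDiag t m N o ≤ cParam t m N ^ 2 := by
  rcases o with _ | ⟨k, hk⟩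
  · exact le_rfl
  · have hm0 : (0 : ℝ) < m := by exact_mod_cast hm
    have h1 : (k : ℝ) ^ (-t) ≤ (m : ℝ) ^ (-t) :=
      Real.rpow_le_rpow_of_nonpos hm0 (by exact_mod_cast (Finset.mem_Ico.1 hk).1) (by linarith)
    simp only [inputDiag]
    gcongr
    exact h1.trans (rpow_neg_le_cParam t m N)

lemma memLp_inputB [IsFiniteMeasure μ] (hb : IsOrthonormalSystem μ b) (o) :
    MemLp (fun x => inputB b t m N x o) 2 μ := by
  rcases o with _ | k
  · exact memLp_const _
  · exact (hb.1 k.1).const_mul _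

/-- The constant entry is c b_0, and m ≥ 1 keeps the index 0 out of the other entries, so all
entries are orthogonal. -/
lemma gramJ_inputB [IsProbabilityMeasure μ] (hb : IsOrthonormalSystem μ b) (h0 : ∀ x, b 0 x = 1)
    (hm : 1 ≤ m) : gramJ μ (inputB b t m N) = diagonal fun o => (inputDiag t m N o : ℂ) := by
  ext i j
  have e0 : ∀ k, 1 ≤ k → ∫ x, star (b k x) ∂μ = 0 := fun k hk => by
    have := hb.2 0 k
    simpa [h0, show (0 : ℕ) ≠ k by omega] using this
  have e1 : ∀ k, 1 ≤ k → ∫ x, b k x ∂μ = 0 := fun k hk => by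
    have := hb.2 k 0
    simpa [h0, show k ≠ 0 by omega] using this
  simp only [gramJ, of_apply, outer, vecMulVec_apply, Pi.star_apply]
  rcases i with _ | ⟨i, hi⟩ <;> rcases j with _ | ⟨j, hj⟩
  · simp [inputB, inputDiag, pow_two]
  · have hj' := hm.trans (Finset.mem_Ico.1 hj).1
    simp only [inputB, star_mul', ← mul_assoc]
    rw [integral_const_mul (_ * _), e0 j hj']
    simp
  · have hi' := hm.trans (Finset.mem_Ico.1 hi).1
    simp only [inputB]
    rw [integral_mul_const, integral_const_mul, e1 i hi']
    simp
  · have : ∀ x, inputB b t m N x (some ⟨i, hi⟩) * star (inputB b t m N x (some ⟨j, hj⟩)) =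
        (((i : ℝ) ^ (-t) * (j : ℝ) ^ (-t) : ℝ) : ℂ) * (b i x * star (b j x)) := by
      intro x
      simp only [inputB, star_mul', Complex.star_def, Complex.conj_ofReal]
      push_cast
      ring
    simp only [this, integral_const_mul, hb.2]
    by_cases hij : i = j
    · subst hij
      simp [inputDiag, pow_two]
    · rw [diagonal_apply_ne _ (by simpa using hij)]
      simp [hij]

lemma lambdaMax_diagonal {κ : Type*} [Fintype κ] [DecidableEq κ] {d : κ → ℝ} {i : κ}
    (h : ∀ j, d j ≤ d i) : lambdaMax (diagonal fun j => (d j : ℂ)) = d i := by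
  have hs : spectrum ℝ (diagonal fun j => (d j : ℂ)) = Set.range d := by
    ext r
    rw [← spectrum.algebraMap_mem_iff ℂ, spectrum_diagonal]
    simp
  rw [lambdaMax, hs]
  exact IsGreatest.csSup_eq ⟨⟨i, rfl⟩, by rintro _ ⟨j, rfl⟩; exact h j⟩

lemma sigmaParam_inputDiag (ht : 0 ≤ t) (hm : 1 ≤ m) :
    sigmaParam (diagonal fun o => (inputDiag t m N o : ℂ)) = cParam t m N := by
  rw [sigmaParam, lambdaMax_diagonal (i := none) (inputDiag_le ht hm N)]
  exact Real.sqrt_sq (cParam_pos t hm N).le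

lemma trace_inputDiag : (diagonal fun o => (inputDiag t m N o : ℂ)).trace.re =
    cParam t m N ^ 2 + ∑ k ∈ Finset.Ico m N, ((k : ℝ) ^ (-t)) ^ 2 := by
  rw [trace_diagonal, Complex.re_sum, Fintype.sum_option, 
    ← Finset.sum_coe_sort (Finset.Ico m N) fun k => ((k : ℝ) ^ (-t)) ^ 2]
  rfl

lemma sParam_inputDiag_pos (hm : 1 ≤ m) :
    0 < sParam (2 * m) (diagonal fun o => (inputDiag t m N o : ℂ)) := by
  have h := cParam_pos t hm N
  have h1 : 0 ≤ ∑ k ∈ Finset.Ico m N, ((k : ℝ) ^ (-t)) ^ 2 :=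
    Finset.sum_nonneg fun _ _ => sq_nonneg _
  have hm0 : (0 : ℝ) < m := by exact_mod_cast hm
  rw [sParam, trace_inputDiag]
  push_cast
  positivity

/-- Divided by 2m, the entry c² of the trace stays below c², and so do the others together: the
second summand of c is chosen for this. -/
lemma sParam_inputDiag_le (hm : 1 ≤ m) :
    sParam (2 * m) (diagonal fun o => (inputDiag t m N o : ℂ)) ≤ 2 * cParam t m N := by
  have h := cParam_pos t hm N
  have hm0 : (1 : ℝ) ≤ m := by exact_mod_cast hm
  have h1 : 1 / (2 * (m : ℝ)) * ∑ k ∈ Finset.Ico m N, ((k : ℝ) ^ (-t)) ^ 2 ≤ cParam t m N ^ 2 := by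
    have h2 : √(1 / (2 * (m : ℝ)) * ∑ k ∈ Finset.Icc m N, (k : ℝ) ^ (-(2 * t))) ≤ cParam t m N :=
      le_add_of_nonneg_left (by positivity)
    rw [Real.sqrt_le_left h.le] at h2
    refine le_trans ?_ h2
    gcongr
    have e : ∀ k : ℕ, ((k : ℝ) ^ (-t)) ^ 2 = (k : ℝ) ^ (-(2 * t)) := fun k => by
      rw [← Real.rpow_natCast, ← Real.rpow_mul (by positivity)]
      congr 1; push_cast; ring
    simp only [e]
    exact Finset.sum_le_sum_of_subset_of_nonneg Finset.Ico_subset_Icc_self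
      fun _ _ _ => by positivity
  rw [sParam, trace_inputDiag, Real.sqrt_le_left (by positivity)]
  push_cast
  have h3 : (cParam t m N ^ 2 + ∑ k ∈ Finset.Ico m N, ((k : ℝ) ^ (-t)) ^ 2) / (2 * (m : ℝ)) =
      cParam t m N ^ 2 * (1 / (2 * (m : ℝ))) +
        1 / (2 * (m : ℝ)) * ∑ k ∈ Finset.Ico m N, ((k : ℝ) ^ (-t)) ^ 2 := by
    field_simp
  have h4 : cParam t m N ^ 2 * (1 / (2 * (m : ℝ))) ≤ cParam t m N ^ 2 * 1 := by
    gcongr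
    rw [div_le_one (by linarith)]
    linarith
  rw [h3]
  nlinarith

lemma posDef_inputDiag (hm : 1 ≤ m) : (diagonal fun o => (inputDiag t m N o : ℂ)).PosDef :=
  PosDef.diagonal fun o => by exact_mod_cast inputDiag_pos t hm N o

/-- The designs exist. -/
theorem exists_isLeastSquaresDesign [IsProbabilityMeasure μ] (hb : IsOrthonormalSystem μ b)
    (h0 : ∀ x, b 0 x = 1) (ht : 0 ≤ t) (hm : 1 ≤ m) (N : ℕ) :
    ∃ (x : Fin (2 * m) → D) (w : Fin (2 * m) → ℝ), IsLeastSquaresDesign μ b t m N x w := by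
  refine exists_isOutput hm (by omega) (memLp_inputA hb) (gramJ_inputA hb) (memLp_inputB hb)
    (fun x hx => ?_) ?_ ?_ ?_
  · have := congrFun hx none
    simp only [inputB, Pi.zero_apply, Complex.ofReal_eq_zero] at this
    exact (cParam_pos t hm N).ne' this
  · rw [gramJ_inputB hb h0 hm]; exact posDef_inputDiag hm
  · rw [gramJ_inputB hb h0 hm, sigmaParam_inputDiag ht hm]; exact cParam_pos t hm N
  · rw [gramJ_inputB hb h0 hm]; exact sParam_inputDiag_pos hm

/-- The lower frame constant of the designs. -/
noncomputable def frameConst (m : ℕ) : ℝ :=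
  (2 * m : ℕ) * deltaStar m (2 * m) - rParam m (2 * m) * (1 - rParam m (2 * m))

lemma frameConst_eq (m : ℕ) :
    frameConst m = (1 - rParam m (2 * m)) * (2 * m / (2 * m + 1) - rParam m (2 * m)) := by
  rw [frameConst, deltaStar]
  push_cast
  ring

/-- Since r² = m/(2m + 1), the claim r < 2m/(2m + 1) amounts to 1 < 2m. -/
lemma frameConst_pos (hm : 1 ≤ m) : 0 < frameConst m := by
  have hr1 := rParam_lt_one (show m ≤ 2 * m by omega)
  have hsq := rParam_sq m (2 * m)
  have hm1 : (1 : ℝ) ≤ m := by exact_mod_cast hm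
  rw [frameConst_eq]
  refine mul_pos (by linarith) (sub_pos.2 (lt_of_pow_lt_pow_left₀ 2 (by positivity) ?_))
  push_cast at hsq
  rw [div_pow, lt_div_iff₀ (by positivity)]
  have : rParam m (2 * m) ^ 2 * (2 * m + 1 : ℝ) ^ 2 = m * (2 * m + 1) := by
    rw [pow_two (2 * m + 1 : ℝ), ← mul_assoc, hsq]
  rw [this]
  nlinarith

/-- A bound independent of m: r < 1/√2 ≤ 0.7072, while 2m/(2m + 1) ≥ 4/5. -/
lemma le_frameConst (hm : 2 ≤ m) : 1 / 50 ≤ frameConst m := by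
  have hsq := rParam_sq m (2 * m)
  have hm1 : (2 : ℝ) ≤ m := by exact_mod_cast hm
  push_cast at hsq
  have h1 : rParam m (2 * m) ≤ 0.7072 := by
    refine (abs_le_of_sq_le_sq' ?_ (by norm_num)).2
    have : rParam m (2 * m) ^ 2 = m / (2 * m + 1) := by
      rw [eq_div_iff (by positivity)]; exact hsq
    rw [this, div_le_iff₀ (by positivity)]
    norm_num
    linarith
  have h2 : (0.8 : ℝ) ≤ 2 * m / (2 * m + 1) := by
    rw [le_div_iff₀ (by positivity)]
    linarith
  rw [frameConst_eq]
  calc (1 / 50 : ℝ) ≤ (1 - 0.7072) * (0.8 - 0.7072) := by norm_num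
    _ ≤ _ := by gcongr; linarith

lemma quadForm_sum_outer {κ : Type*} [Fintype κ] {n : ℕ} (w : Fin n → ℝ) (v : Fin n → κ → ℂ)
    (z : κ → ℂ) : quadForm (∑ i, (w i : ℂ) • outer (v i)) z =
      ∑ i, w i * ‖star z ⬝ᵥ v i‖ ^ 2 := by
  rw [quadForm_sum]
  exact Finset.sum_congr rfl fun i _ => by rw [quadForm_smul, quadForm_outer]

variable {x : Fin (2 * m) → D} {w : Fin (2 * m) → ℝ}

section

variable [IsProbabilityMeasure μ] (hb : IsOrthonormalSystem μ b) (h0 : ∀ x, b 0 x = 1)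
  (ht : 0 ≤ t) (hm : 1 ≤ m) (h : IsLeastSquaresDesign μ b t m N x w)
include hb h0 ht hm h

/-- With σ = c and J ≤ c², the upper barrier ((c + s)/c) J + s(c + s) is at most (c + s)², and s ≤
2c. -/
lemma IsLeastSquaresDesign.spectral :
    (∀ i, 0 < w i) ∧
    ((∑ i, (w i : ℂ) • outer (inputA b m (x i))) - (frameConst m : ℂ) • 1).PosDef ∧
    ∀ z, ∑ i, w i * ‖star z ⬝ᵥ inputB b t m N (x i)‖ ^ 2 ≤
      9 * cParam t m N ^ 2 * ∑ o, ‖z o‖ ^ 2 := by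
  have hc := cParam_pos t hm N
  have hm0 : (0 : ℝ) < m := by exact_mod_cast hm
  have hJ := gramJ_inputB (t := t) (N := N) hb h0 hm
  have hs := sParam_inputDiag_pos (t := t) (N := N) hm
  have hs2 := sParam_inputDiag_le (t := t) (N := N) hm
  have hσ := sigmaParam_inputDiag (N := N) ht hm
  obtain ⟨h1, h2, h3⟩ := IsOutput.posDef hm (by omega) (by rw [hJ]; exact posDef_inputDiag hm)
    (by rw [hJ, hσ]; exact hc) (by rw [hJ]; exact hs) h
  refine ⟨h1, h2, fun z => ?_⟩
  have h4 := h3.posSemidef.quadForm_nonneg z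
  rw [hJ, quadForm_sub, quadForm_add, quadForm_smul, quadForm_smul, quadForm_one,
    quadForm_diagonal, quadForm_sum_outer, zetaStar, hσ] at h4
  set s := sParam (2 * m) (diagonal fun o => (inputDiag t m N o : ℂ))
  set c := cParam t m N
  set Z := ∑ o, ‖z o‖ ^ 2
  have h5 : ∑ o, inputDiag t m N o * ‖z o‖ ^ 2 ≤ c ^ 2 * Z := by
    rw [Finset.mul_sum]
    exact Finset.sum_le_sum fun o _ => by gcongr; exact inputDiag_le ht hm N o
  have hZ : 0 ≤ Z := Finset.sum_nonneg fun _ _ => sq_nonneg _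
  have h6 : ((2 * m : ℕ) : ℝ) * ((c + s) / (c * ((2 * m : ℕ) : ℝ))) = (c + s) / c := by
    push_cast
    field_simp
  rw [h6] at h4
  have h7 : (c + s) / c * ∑ o, inputDiag t m N o * ‖z o‖ ^ 2 ≤ (c + s) / c * (c ^ 2 * Z) := by
    gcongr
  have h8 : (c + s) / c * (c ^ 2 * Z) = (c + s) * c * Z := by field_simp
  have h9 : (c + s) * c * Z + s * (c + s) * Z = (c + s) ^ 2 * Z := by ring
  have h10 : (c + s) ^ 2 * Z ≤ (3 * c) ^ 2 * Z := by gcongr; linarith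
  have h11 : (3 * c) ^ 2 * Z = 9 * c ^ 2 * Z := by ring
  linarith

lemma IsLeastSquaresDesign.weight_pos (i : Fin (2 * m)) : 0 < w i :=
  (h.spectral hb h0 ht hm).1 i

/-- Testing the upper bound on the constant entry gives c² ∑ w_i ≤ 9c²; this is why b contains a
constant. -/
lemma IsLeastSquaresDesign.sum_weight_le : ∑ i, w i ≤ 9 := by
  have hc := cParam_pos t hm N
  have h1 := (h.spectral hb h0 ht hm).2.2 (Pi.single none 1)
  have e1 : ∑ o : Option {k : ℕ // k ∈ Finset.Ico m N},
      ‖(Pi.single none 1 : Option {k : ℕ // k ∈ Finset.Ico m N} → ℂ) o‖ ^ 2 = 1 := by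
    simp [Fintype.sum_option]
  have e2 : ∀ i, ‖star (Pi.single none 1 : Option {k : ℕ // k ∈ Finset.Ico m N} → ℂ) ⬝ᵥ
      inputB b t m N (x i)‖ ^ 2 = cParam t m N ^ 2 := fun i => by
    simp [dotProduct, Fintype.sum_option, inputB]
  simp only [e1, e2] at h1
  rw [← Finset.sum_mul, mul_one] at h1
  exact le_of_mul_le_mul_right h1 (by positivity)

lemma IsLeastSquaresDesign.sum_low (d : ℕ → ℂ) :
    frameConst m * ∑ k ∈ Finset.range m, ‖d k‖ ^ 2 ≤
      ∑ i, w i * ‖∑ k ∈ Finset.range m, d k * b k (x i)‖ ^ 2 := by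
  have h1 := (h.spectral hb h0 ht hm).2.1.posSemidef.quadForm_nonneg fun k => star (d k)
  rw [quadForm_sub, quadForm_smul, quadForm_one, quadForm_sum_outer, sub_nonneg] at h1
  simpa [dotProduct, inputA, Finset.sum_range] using h1

/-- The test vector has entries k^t times the conjugate of d_k, cancelling the factors k^{-t} in b,
and vanishes at the constant entry. -/
lemma IsLeastSquaresDesign.sum_high (d : ℕ → ℂ) :
    ∑ i, w i * ‖∑ k ∈ Finset.Ico m N, d k * b k (x i)‖ ^ 2 ≤
      9 * cParam t m N ^ 2 * ∑ k ∈ Finset.Ico m N, (k : ℝ) ^ (2 * t) * ‖d k‖ ^ 2 := by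
  have h1 := (h.spectral hb h0 ht hm).2.2 fun o => o.elim 0 fun k => ((k.1 : ℝ) ^ t : ℝ) * star (d k.1)
  rw [Fintype.sum_option] at h1
  have e1 : ∀ k : {k : ℕ // k ∈ Finset.Ico m N}, 0 < (k.1 : ℝ) := fun k => by
    exact_mod_cast hm.trans (Finset.mem_Ico.1 k.2).1
  have e2 : ∀ k : {k : ℕ // k ∈ Finset.Ico m N},
      ‖(((k.1 : ℝ) ^ t : ℝ) : ℂ) * star (d k.1)‖ ^ 2 = (k.1 : ℝ) ^ (2 * t) * ‖d k.1‖ ^ 2 := fun k => by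
    have := e1 k
    rw [norm_mul, mul_pow, norm_star, Complex.norm_real, Real.norm_of_nonneg (by positivity),
      ← Real.rpow_natCast, ← Real.rpow_mul (by positivity), mul_comm t]
    norm_num
  have e3 : ∀ y, (star fun o : Option {k : ℕ // k ∈ Finset.Ico m N} =>
      o.elim 0 fun k => (((k.1 : ℝ) ^ t : ℝ) : ℂ) * star (d k.1)) ⬝ᵥ inputB b t m N y =
        ∑ k ∈ Finset.Ico m N, d k * b k y := fun y => by
    rw [dotProduct, Fintype.sum_option, ← Finset.sum_coe_sort (Finset.Ico m N) fun k => d k * b k y]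
    simp only [Pi.star_apply, Option.elim_none, star_zero, zero_mul, zero_add, Option.elim_some]
    refine Finset.sum_congr rfl fun k _ => ?_
    have h2 : (((k.1 : ℝ) ^ t : ℝ) : ℂ) * (((k.1 : ℝ) ^ (-t) : ℝ) : ℂ) = 1 := by
      rw [← Complex.ofReal_mul, ← Real.rpow_add (e1 k)]
      simp
    simp only [inputB, star_mul', Complex.star_def, Complex.conj_ofReal, Complex.conj_conj]
    calc _ = ((((k.1 : ℝ) ^ t : ℝ) : ℂ) * (((k.1 : ℝ) ^ (-t) : ℝ) : ℂ)) * (d k.1 * b k.1 y) := by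
          ring
      _ = _ := by rw [h2, one_mul]
  simp only [e3, Option.elim_none, Option.elim_some, e2] at h1
  rw [← Finset.sum_coe_sort (Finset.Ico m N) fun k => (k : ℝ) ^ (2 * t) * ‖d k‖ ^ 2]
  simpa using h1

/-- Weighted least squares is well defined. -/
theorem IsLeastSquaresDesign.existsUnique (f : D → ℂ) :
    ∃! g : D → ℂ, IsLeastSquares (approxSpace b m) x w f g := by
  have hw := h.weight_pos hb h0 ht hm
  simp only [isLeastSquares_iff hw]
  refine existsUnique_least_squares (weightedEval x w) _ (fun g hg hg0 => ?_) f
  obtain ⟨c, rfl⟩ := mem_approxSpace_iff.1 hg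
  have h1 := h.sum_low hb h0 ht hm c
  have h2 := norm_weightedEval_sq x hw (fun x => ∑ k ∈ Finset.range m, c k * b k x)
  rw [hg0, norm_zero] at h2
  rw [← h2] at h1
  have h3 : ∑ k ∈ Finset.range m, ‖c k‖ ^ 2 ≤ 0 := by
    have := frameConst_pos hm
    by_contra! hcon
    have := mul_pos this hcon
    norm_num at h1
    linarith
  have h4 : ∑ k ∈ Finset.range m, ‖c k‖ ^ 2 = 0 := le_antisymm h3 (by positivity)
  rw [Finset.sum_eq_zero_iff_of_nonneg fun k _ => by positivity] at h4
  ext y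
  change ∑ k ∈ Finset.range m, c k * b k y = 0
  refine Finset.sum_eq_zero fun k hk => ?_
  have : c k = 0 := by simpa using h4 k hk
  rw [this, zero_mul]

end

end Design

end WLS

namespace WLS

/-! ### Error bounds -/

section Error

/-- The exponent α/(α - θ) decreases in α, so the choice for α₀ serves every α ≥ α₀. The factor 2
comes from N + m ≤ 2 max(N, m). -/
lemma rpow_div_sub_le {θ α₀ α : ℝ} (hθ : 0 ≤ θ) (h0 : θ < α₀) (hα : α₀ ≤ α) {m N : ℕ} (hm : 1 ≤ m)
    (hN : (m : ℝ) ^ (α₀ / (α₀ - θ)) - (m : ℝ) ≤ (N : ℝ)) :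
    (m : ℝ) ^ (α / (α - θ)) ≤ 2 * ((max N m : ℕ) : ℝ) := by
  have hm1 : (1 : ℝ) ≤ m := by exact_mod_cast hm
  have h1 : α / (α - θ) ≤ α₀ / (α₀ - θ) := by
    rw [div_le_div_iff₀ (by linarith) (by linarith)]
    nlinarith
  have h2 := Real.rpow_le_rpow_of_exponent_le hm1 h1
  have h3 : (N : ℝ) ≤ ((max N m : ℕ) : ℝ) := by exact_mod_cast le_max_left N m
  have h4 : (m : ℝ) ≤ ((max N m : ℕ) : ℝ) := by exact_mod_cast le_max_right N m
  linarith

/-- The maximum covers the permitted case N < m, in which the block is empty. -/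
lemma partialSum_sub {D : Type*} [MeasurableSpace D] (μ : Measure D) (b : ℕ → D → ℂ) (f : D → ℂ)
    (m N : ℕ) (x : D) :
    partialSum μ b f (max N m) x - partialSum μ b f m x =
      ∑ k ∈ Finset.Ico m N, fourierCoef μ b f k * b k x := by
  rw [partialSum, partialSum, ← Finset.sum_Ico_eq_sub _ (le_max_right N m)]
  rcases le_total m N with h | h
  · rw [max_eq_left h]
  · rw [max_eq_right h, Finset.Ico_self, Finset.Ico_eq_empty_of_le h]

/-- The error bound in `L₂` and in the supremum norm. -/
theorem exists_error_le {θ t α β : ℝ} (hθ : 1 / 2 ≤ θ) (hθt : θ < t) (htα : t < α) (hβ : 0 ≤ β)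
    (C₁ C₂ : ℝ) :
    ∃ C : ℝ, 0 < C ∧ ∀ (D : Type*) [MeasurableSpace D] (μ : Measure D) [IsProbabilityMeasure μ]
      (b : ℕ → D → ℂ), IsOrthonormalSystem μ b → (∀ x, b 0 x = 1) →
      (∀ m : ℕ, 2 ≤ m → christoffelSup μ (approxSpace b m) ≤ ENNReal.ofReal (C₁ * (m : ℝ) ^ θ)) →
      ∀ α₀ : ℝ, t < α₀ → α₀ ≤ α → ∀ m N : ℕ, 2 ≤ m →
      (m : ℝ) ^ (α₀ / (α₀ - θ)) - (m : ℝ) ≤ (N : ℝ) →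
      ∀ (x : Fin (2 * m) → D) (w : Fin (2 * m) → ℝ), IsLeastSquaresDesign μ b t m N x w →
      ∀ f g : D → ℂ, MemLp f 2 μ → HasPointwiseFourierSeries μ b f →
      (∀ k : ℕ, 2 ≤ k → bestL2 μ f (approxSpace b k) ≤
        ENNReal.ofReal (C₂ * (k : ℝ) ^ (-α) * Real.log k ^ β)) →
      IsLeastSquares (approxSpace b m) x w f g →
      eLpNorm (f - g) 2 μ ≤ ENNReal.ofReal (C * decay α β m) ∧
        ∀ y, ‖f y - g y‖ ≤ C * decay (α - θ) β m := by
  obtain ⟨B₁, hB₁, hsup⟩ := exists_norm_sub_partialSum_le (hθt.trans htα) hβ C₁ |C₂|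
  obtain ⟨B₂, hB₂, hsum⟩ := exists_weighted_sum_le (by linarith : 0 ≤ t) htα hβ |C₂|
  obtain ⟨B₃, hB₃, hc⟩ := exists_cParam_le (by linarith : 1 / 2 < t)
  obtain ⟨B₄, hB₄, hdec⟩ := exists_decay_le (by linarith : 0 < θ) (hθt.trans htα) hβ
  -- Here 18 = 2 · 9: splitting the square of a sum costs 2, and both pieces carry the constant 9 of
  -- the upper barrier. The 50 in R inverts the frame bound.
  set Q : ℝ := 18 * (B₃ ^ 2 * B₂ + (B₁ * B₄) ^ 2) with hQ
  set R : ℝ := √(50 * Q) with hR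
  refine ⟨|C₂| + R + (B₁ + |C₁| * R), by positivity, ?_⟩
  intro D _ μ _ b hb h0 hΛ α₀ htα₀ hα₀ m N hm hN x w hd f g hf hF hbest hg
  have hm1 : 1 ≤ m := by omega
  have hm0 : (0 : ℝ) < m := by exact_mod_cast hm1
  have ht0 : 0 ≤ t := by linarith
  have hbest' : ∀ k : ℕ, 2 ≤ k →
      bestL2 μ f (approxSpace b k) ≤ ENNReal.ofReal (|C₂| * decay α β k) := fun k hk => by
    refine (hbest k hk).trans (ENNReal.ofReal_le_ofReal ?_)
    rw [mul_assoc]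
    exact mul_le_mul_of_nonneg_right (le_abs_self _) (decay_nonneg α β k)
  have hdm := decay_nonneg α β m
  have hdm' := decay_nonneg (α - θ) β m
  have htail : ∀ k : ℕ, 2 ≤ k → ∀ s : Finset ℕ, (∀ j ∈ s, k ≤ j) →
      ∑ j ∈ s, ‖fourierCoef μ b f j‖ ^ 2 ≤ (|C₂| * decay α β k) ^ 2 := fun k hk s hs =>
    hb.sum_sq_fourierCoef_le hf hs (mul_nonneg (abs_nonneg _) (decay_nonneg _ _ _)) (hbest' k hk)
  have hS := hsup hb hΛ f hF htail
  have hw := hd.weight_pos hb h0 ht0 hm1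
  set P := partialSum μ b f m with hP
  have hPm : P ∈ approxSpace b m := sum_mem_approxSpace (fun k hk => Finset.mem_range.1 hk) _
  obtain ⟨hgm, hmin⟩ := (isLeastSquares_iff hw).1 hg
  -- the discrete norm of the residual of the partial sum
  have hdisc : ∑ i, w i * ‖(f - P) (x i)‖ ^ 2 ≤ Q * decay α β m ^ 2 := by
    have hhigh := hd.sum_high hb h0 ht0 hm1 (fourierCoef μ b f)
    have hws := hsum (fun j => ‖fourierCoef μ b f j‖ ^ 2) (fun j => sq_nonneg _) htail m N hm
    have hcm : cParam t m N * decay (α - t) β m ≤ B₃ * decay α β m := by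
      calc _ ≤ (B₃ * (m : ℝ) ^ (-t)) * decay (α - t) β m :=
            mul_le_mul_of_nonneg_right (hc m N hm1) (decay_nonneg _ _ _)
        _ = _ := by rw [mul_assoc, rpow_mul_decay hm1]; congr 2; ring
    have h1 : ∑ i, w i * ‖∑ k ∈ Finset.Ico m N, fourierCoef μ b f k * b k (x i)‖ ^ 2 ≤
        9 * (B₃ ^ 2 * B₂) * decay α β m ^ 2 := by
      calc _ ≤ 9 * cParam t m N ^ 2 * (B₂ * decay (α - t) β m ^ 2) := hhigh.trans (by gcongr)
        _ = 9 * B₂ * (cParam t m N * decay (α - t) β m) ^ 2 := by ring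
        _ ≤ 9 * B₂ * (B₃ * decay α β m) ^ 2 := by
            have := mul_nonneg (cParam_pos t hm1 N).le (decay_nonneg (α - t) β m)
            gcongr
        _ = _ := by ring
    have h2 : ∀ i, ‖f (x i) - partialSum μ b f (max N m) (x i)‖ ≤ B₁ * B₄ * decay α β m := by
      intro i
      have hK : 2 ≤ max N m := hm.trans (le_max_right _ _)
      refine (hS _ hK (x i)).trans ?_
      rw [mul_assoc]
      gcongr
      exact hdec m _ hm hK (rpow_div_sub_le (by linarith) (hθt.trans htα₀) hα₀ hm1 hN)
    have h3 : ∀ i, ‖(f - P) (x i)‖ ^ 2 ≤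
        2 * ‖∑ k ∈ Finset.Ico m N, fourierCoef μ b f k * b k (x i)‖ ^ 2 +
          2 * (B₁ * B₄ * decay α β m) ^ 2 := by
      intro i
      have e : (f - P) (x i) = (∑ k ∈ Finset.Ico m N, fourierCoef μ b f k * b k (x i)) +
          (f (x i) - partialSum μ b f (max N m) (x i)) := by
        rw [← partialSum_sub, Pi.sub_apply]; ring
      rw [e]
      refine (pow_le_pow_left₀ (norm_nonneg _) (norm_add_le _ _) 2).trans ?_
      have := pow_le_pow_left₀ (norm_nonneg _) (h2 i) 2
      nlinarith [add_sq_le (a := ‖∑ k ∈ Finset.Ico m N, fourierCoef μ b f k * b k (x i)‖)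
        (b := ‖f (x i) - partialSum μ b f (max N m) (x i)‖)]
    calc _ ≤ ∑ i, w i * (2 * ‖∑ k ∈ Finset.Ico m N, fourierCoef μ b f k * b k (x i)‖ ^ 2 +
          2 * (B₁ * B₄ * decay α β m) ^ 2) :=
          Finset.sum_le_sum fun i _ => mul_le_mul_of_nonneg_left (h3 i) (hw i).le
      _ = 2 * ∑ i, w i * ‖∑ k ∈ Finset.Ico m N, fourierCoef μ b f k * b k (x i)‖ ^ 2 +
          (∑ i, w i) * (2 * (B₁ * B₄ * decay α β m) ^ 2) := by
          rw [Finset.mul_sum, Finset.sum_mul, ← Finset.sum_add_distrib]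
          exact Finset.sum_congr rfl fun i _ => by ring
      _ ≤ 2 * (9 * (B₃ ^ 2 * B₂) * decay α β m ^ 2) + 9 * (2 * (B₁ * B₄ * decay α β m) ^ 2) := by
          gcongr
          exact hd.sum_weight_le hb h0 ht0 hm1
      _ = _ := by rw [hQ]; ring
  -- the error of least squares compared with the partial sum
  obtain ⟨d, hde⟩ := mem_approxSpace_iff.1 (Submodule.sub_mem _ hgm hPm)
  have hcontr := least_squares_contraction _ _ hgm hmin hPm
  rw [norm_weightedEval_sq x hw, norm_weightedEval_sq x hw] at hcontr
  have hdR : √(∑ k ∈ Finset.range m, ‖d k‖ ^ 2) ≤ R * decay α β m := by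
    have h1 := hd.sum_low hb h0 ht0 hm1 d
    have h2 : ∑ i, w i * ‖∑ k ∈ Finset.range m, d k * b k (x i)‖ ^ 2 ≤ Q * decay α β m ^ 2 := by
      refine le_trans (le_of_eq ?_) (hcontr.trans hdisc)
      exact Finset.sum_congr rfl fun i _ => by rw [congrFun hde (x i)]
    have h3 : 1 / 50 * ∑ k ∈ Finset.range m, ‖d k‖ ^ 2 ≤
        frameConst m * ∑ k ∈ Finset.range m, ‖d k‖ ^ 2 :=
      mul_le_mul_of_nonneg_right (le_frameConst hm) (by positivity)
    rw [Real.sqrt_le_left (by positivity), mul_pow, hR, Real.sq_sqrt (by positivity)]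
    linarith
  have hfg : f - g = (f - P) - (g - P) := by abel
  have hC₁R : 0 ≤ B₁ + |C₁| * R := by positivity
  constructor
  · have h1 : eLpNorm (f - P) 2 μ ≤ ENNReal.ofReal (|C₂| * decay α β m) :=
      (hb.eLpNorm_sub_partialSum_le hf m).trans (hbest' m hm)
    have h2 : eLpNorm (g - P) 2 μ ≤ ENNReal.ofReal (R * decay α β m) := by
      rw [hde, hb.eLpNorm_sum]
      exact ENNReal.ofReal_le_ofReal hdR
    have hPL := (hb.memLp_of_mem hPm).aestronglyMeasurable
    have hgL := (hb.memLp_of_mem hgm).aestronglyMeasurable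
    rw [hfg]
    refine (eLpNorm_sub_le (hf.aestronglyMeasurable.sub hPL) (hgL.sub hPL) (by norm_num)).trans ?_
    refine (add_le_add h1 h2).trans ?_
    rw [← ENNReal.ofReal_add (by positivity) (by positivity)]
    refine ENNReal.ofReal_le_ofReal ?_
    have := mul_nonneg hC₁R hdm
    linarith
  · intro y
    have h1 : ‖f y - P y‖ ≤ B₁ * decay (α - θ) β m := hS m hm y
    have h2 : ‖g y - P y‖ ≤ |C₁| * R * decay (α - θ) β m := by
      have hL : christoffelSup μ (approxSpace b m) ≤ ENNReal.ofReal (|C₁| * (m : ℝ) ^ θ) := by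
        refine (hΛ m hm).trans (ENNReal.ofReal_le_ofReal ?_)
        gcongr
        exact le_abs_self _
      have h3 := hb.norm_sum_le hL (s := Finset.range m) (fun k hk => Finset.mem_range.1 hk) d
        (by positivity) y
      have h4 : g y - P y = ∑ k ∈ Finset.range m, d k * b k y := congrFun hde y
      rw [h4]
      refine h3.trans ((mul_le_mul_of_nonneg_left hdR (by positivity)).trans (le_of_eq ?_))
      rw [← rpow_mul_decay hm1]
      ring
    have h3 : f y - g y = (f y - P y) - (g y - P y) := by ring
    rw [h3]
    refine (norm_sub_le _ _).trans ((add_le_add h1 h2).trans ?_)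
    have : 0 ≤ (|C₂| + R) * decay (α - θ) β m := by positivity
    linarith

lemma two_div_toReal (p : ℝ≥0∞) : (2 / p).toReal = 2 / p.toReal := by
  rw [ENNReal.toReal_div, ENNReal.toReal_ofNat]

/-- For p ≤ 2 the norms are monotone on a probability space; for larger finite p, interpolation
gives (LA)^{1-2/p} A^{2/p} = L^{1-2/p} A. It is applied with L = m^θ. -/
lemma eLpNorm_le_of_two_of_sup {D : Type*} [MeasurableSpace D] {μ : Measure D}
    [IsProbabilityMeasure μ] {h : D → ℂ} (hh : AEStronglyMeasurable h μ) {p : ℝ≥0∞} (hp : 1 ≤ p)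
    {A L : ℝ} (hA : 0 ≤ A) (hL : 0 < L) (h2 : eLpNorm h 2 μ ≤ ENNReal.ofReal A)
    (hsup : ∀ y, ‖h y‖ ≤ L * A) :
    eLpNorm h p μ ≤ ENNReal.ofReal (L ^ max (1 - (2 / p).toReal) 0 * A) := by
  have hM : ∀ y, ‖h y‖ₑ ≤ ENNReal.ofReal (L * A) := fun y => by
    rw [← ofReal_norm]; exact ENNReal.ofReal_le_ofReal (hsup y)
  rcases eq_or_ne p ∞ with rfl | hpt
  · have : (2 / ∞ : ℝ≥0∞).toReal = 0 := by simp
    rw [this, sub_zero, max_eq_left zero_le_one, Real.rpow_one, eLpNorm_exponent_top]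
    exact essSup_le_of_ae_le _ (Eventually.of_forall hM)
  have hp0 : 0 < p.toReal := ENNReal.toReal_pos (by positivity) hpt
  rw [two_div_toReal]
  rcases le_total p 2 with hp2 | hp2
  · have h3 : p.toReal ≤ 2 := by
      simpa using ENNReal.toReal_mono ENNReal.ofNat_ne_top hp2
    have h4 : 1 ≤ 2 / p.toReal := by rwa [le_div_iff₀ hp0, one_mul]
    rw [max_eq_right (by linarith), Real.rpow_zero, one_mul]
    exact (eLpNorm_le_eLpNorm_of_exponent_le hp2 hh).trans h2
  · have h3 : 2 ≤ p.toReal := by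
      simpa using ENNReal.toReal_mono hpt hp2
    have h4 : 2 / p.toReal ≤ 1 := by rwa [div_le_one hp0]
    have h5 := eLpNorm_le_interpolation (μ := μ) (f := h) h3 ENNReal.ofReal_ne_top hM
    rw [ENNReal.ofReal_toReal hpt] at h5
    have h6 : 0 ≤ 2 / p.toReal := by positivity
    rw [max_eq_left (by linarith)]
    calc _ ≤ _ := h5
      _ ≤ ENNReal.ofReal (L * A) ^ (1 - 2 / p.toReal) * ENNReal.ofReal A ^ (2 / p.toReal) := by
          gcongr
      _ = ENNReal.ofReal (L ^ (1 - 2 / p.toReal) * A) := by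
          rw [ENNReal.ofReal_rpow_of_nonneg (by positivity) (by linarith),
            ENNReal.ofReal_rpow_of_nonneg hA h6, ← ENNReal.ofReal_mul (by positivity),
            Real.mul_rpow hL.le hA, mul_assoc, ← Real.rpow_add_of_nonneg hA (by linarith) h6,
            sub_add_cancel, Real.rpow_one]

end Error

end WLS

theorem theorem4p4 (θ t α β C₁ C₂ : ℝ) (p : ℝ≥0∞)
    (hθ : 1 / 2 ≤ θ) (hθt : θ < t) (htα : t < α) (hβ : 0 ≤ β) (hp : 1 ≤ p) :
    ∃ C : ℝ, 0 < C ∧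
      ∀ (D : Type*) [MeasurableSpace D] (μ : Measure D) [IsProbabilityMeasure μ]
        (b : ℕ → D → ℂ), WLS.IsOrthonormalSystem μ b → (∀ x, b 0 x = 1) →
        (∀ m : ℕ, 2 ≤ m →
          WLS.christoffelSup μ (WLS.approxSpace b m) ≤ ENNReal.ofReal (C₁ * (m : ℝ) ^ θ)) →
      ∀ α₀ : ℝ, t < α₀ → α₀ ≤ α →
      ∀ m N : ℕ, 1 ≤ m → (m : ℝ) ^ (α₀ / (α₀ - θ)) - (m : ℝ) ≤ (N : ℝ) →
        (∃ (x : Fin (2 * m) → D) (w : Fin (2 * m) → ℝ), WLS.IsLeastSquaresDesign μ b t m N x w) ∧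
        ∀ (x : Fin (2 * m) → D) (w : Fin (2 * m) → ℝ), WLS.IsLeastSquaresDesign μ b t m N x w →
          (∀ f : D → ℂ, ∃! g : D → ℂ, WLS.IsLeastSquares (WLS.approxSpace b m) x w f g) ∧
          ∀ f g : D → ℂ, 2 ≤ m →
            MemLp f 2 μ → (∃ M : ℝ, ∀ y, ‖f y‖ ≤ M) → WLS.HasPointwiseFourierSeries μ b f →
            (∀ k : ℕ, 2 ≤ k →
              WLS.bestL2 μ f (WLS.approxSpace b k) ≤
                ENNReal.ofReal (C₂ * (k : ℝ) ^ (-α) * Real.log k ^ β)) →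
            WLS.IsLeastSquares (WLS.approxSpace b m) x w f g →
            eLpNorm (f - g) p μ ≤
                ENNReal.ofReal
                  (C * (m : ℝ) ^ (-α + θ * max (1 - (2 / p).toReal) 0) * Real.log m ^ β) ∧
              (p = ∞ → WLS.supNorm (f - g) ≤
                ENNReal.ofReal (C * (m : ℝ) ^ (-α + θ) * Real.log m ^ β)) := by
  obtain ⟨C, hC, hmain⟩ := WLS.exists_error_le hθ hθt htα hβ C₁ C₂
  refine ⟨C, hC, ?_⟩
  intro D _ μ _ b hb h0 hΛ α₀ htα₀ hα₀ m N hm hN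
  have ht0 : 0 ≤ t := by linarith
  refine ⟨WLS.exists_isLeastSquaresDesign hb h0 ht0 hm N, fun x w hd =>
    ⟨hd.existsUnique hb h0 ht0 hm, fun f g hm2 hf _ hF hbest hg => ?_⟩⟩
  obtain ⟨h2, hsup⟩ := hmain D μ b hb h0 hΛ α₀ htα₀ hα₀ m N hm2 hN x w hd f g hf hF hbest hg
  have hm0 : (0 : ℝ) < m := by exact_mod_cast hm
  constructor
  · have hA : 0 ≤ C * WLS.decay α β m := mul_nonneg hC.le (WLS.decay_nonneg _ _ _)
    have h3 := WLS.eLpNorm_le_of_two_of_sup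
      (hf.aestronglyMeasurable.sub (hb.memLp_of_mem hg.1).aestronglyMeasurable) hp hA
      (Real.rpow_pos_of_pos hm0 θ) h2 fun y => by
        refine (hsup y).trans (le_of_eq ?_)
        rw [← WLS.rpow_mul_decay hm]; ring
    refine h3.trans (ENNReal.ofReal_le_ofReal (le_of_eq ?_))
    rw [← Real.rpow_mul hm0.le, Real.rpow_add hm0, WLS.decay]
    ring
  · intro _
    refine iSup_le fun y => ?_
    rw [← ofReal_norm]
    refine ENNReal.ofReal_le_ofReal ((hsup y).trans (le_of_eq ?_))
    rw [WLS.decay, mul_assoc]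
    congr 3
    ring
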